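/- Throughout, $d\ge 0$ is an integer. A labelled Delone set is (the graph of) a map from a uniformly discrete, relatively dense subset of $\mathbb R^d$ to a compact metric space of labels. Two labelled Delone sets with labels in the same space are $\varepsilon$-close if there is a one-to-one correspondence between some of their points, involving at least all points of norm $<1/\varepsilon$ of both, such that corresponding points have $\varepsilon$-close positions and $\varepsilon$-close labels; this defines the topology. A *tiling space* $\Omega$ is a space of labelled Delone sets $T$ in $\mathbb R^d$ that is the closure of a translation orbit $\{T-x : x\in\mathbb R^d\}$, that is minimal (every orbit is dense) and aperiodic ($T-x=T$ only for $x=0$). (A labelled tiling is regarded as the labelled Delone set of the punctures of its tiles, each labelled by its prototile and label.) $\Omega$ has FLC if for each $R$ there are, up to translation, only finitely many patches $T\cap B(x,R)$, $T\in\Omega$, $x\in\mathbb R^d$. A map between tiling spaces is *orbit-preserving* if it maps each orbit into an orbit; an *orbit equivalence* is a homeomorphism that maps each orbit onto an orbit. A *factor map* is a continuous map $\varphi$ with $\varphi(T-x)=\varphi(T)-x$; it is a *local derivation* if moreover for each $r>0$ there is $R>0$ such that $T\cap B(0,R)=T'\cap B(0,R)$ implies $\varphi(T)\cap B(0,r)=\varphi(T')\cap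 B(0,r)$. *Weak class.* $H^1_w(\Omega;\mathbb R^d)$ is the group of continuous $\alpha:\Omega\times\mathbb R^d\to\mathbb R^d$ with $\alpha(T,x)+\alpha(T-x,y)=\alpha(T,x+y)$, modulo those of the form $(T,v)\mapsto s(T-v)-s(T)$ with $s:\Omega\to\mathbb R^d$ continuous. For a continuous orbit-preserving $h:\Omega\to\Omega'$, the equation $h(T-v)=h(T)-h_T(v)$ defines such a cocycle $(T,v)\mapsto h_T(v)$, and $[h]_w$ is its class. *Strong class.* Let $\Omega'$ have FLC, and let $\rho>0$ be such that distinct points of any $T\in\Omega'$ are at distance at least $2\rho$. The open sets $U_x=\{T : T \text{ has a point in } B(x,\rho)\}$, $x\in\mathbb R^d$, cover $\Omega'$; let $\lambda_x(T)$ be the position of the unique point of $T\in U_x$ in $B(x,\rho)$. The functions $\lambda_x-\lambda_y$ on $U_x\cap U_y$ are locally constant and form a Čech $1$-cocycle; its class $[\mathcal F(\Omega')]\in\check H^1(\Omega';\mathbb R^d)$ is the fundamental shape class (the Čech class of the cocycle $(T,v)\mapsto v$). For a continuous map $h:\Omega\to\Omega'$ of FLC tiling spaces, $[h]_s:=h^*[\mathcal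 F(\Omega')]\in\check H^1(\Omega;\mathbb R^d)\cong H^1_s(\Omega;\mathbb R^d)$. **Theorem.** Let $\Omega,\Omega_1,\Omega_2$ be tiling spaces in $\mathbb R^d$, let $h_1:\Omega\to\Omega_1$ be an orbit equivalence and let $h_2:\Omega\to\Omega_2$ be a continuous orbit-preserving map (for instance a surjective one). 1. If $[h_1]_w=[h_2]_w$ in $H^1_w(\Omega;\mathbb R^d)$, then there is a factor map $\varphi:\Omega_1\to\Omega_2$ such that $h_2$ is homotopic to $\varphi\circ h_1$. 2. If $\Omega,\Omega_1,\Omega_2$ have FLC and $[h_1]_s=[h_2]_s$, then there is a local derivation $\varphi:\Omega_1\to\Omega_2$ such that $h_2$ is homotopic to $\varphi\circ h_1$. -/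

import Mathlib

open Topology

/-- The translation group `ℝ^d` with its Euclidean norm. -/
abbrev Euc (d : ℕ) : Type := EuclideanSpace ℝ (Fin d)

/-- A labelled Delone set in `ℝ^d` with labels in `X`, given by its graph: a set of pairs
`(position, label)`. The field `separated` says at the same time that the set of positions is
uniformly discrete and that each position carries only one label. (`Delone.DeloneSet` is not used
because it carries the two radii as data, so that equal point sets may be different terms.) -/
@[ext]
structure LabeledDelone (d : ℕ) (X : Type*) where
  carrier : Set (Euc d × X)
  separated : ∃ r : ℝ, 0 < r ∧ ∀ p ∈ carrier, ∀ q ∈ carrier, p ≠ q → r ≤ dist p.1 q.1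
  relDense : ∃ R : ℝ, 0 < R ∧ ∀ x : Euc d, ∃ p ∈ carrier, dist p.1 x < R

namespace LabeledDelone

variable {d : ℕ} {X : Type*}

/-- The translate `Λ - x = {(y - x, l) ; (y, l) ∈ Λ}`. -/
def sub (Λ : LabeledDelone d X) (x : Euc d) : LabeledDelone d X where
  carrier := {p | (p.1 + x, p.2) ∈ Λ.carrier}
  separated := by
    obtain ⟨r, hr, h⟩ := Λ.separated
    refine ⟨r, hr, fun p hp q hq hpq => ?_⟩
    have := h _ hp _ hq (fun e => hpq ?_)
    · simpa using this
    · simp only [Prod.mk.injEq, add_left_inj] at e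
      exact Prod.ext e.1 e.2
  relDense := by
    obtain ⟨R, hR, h⟩ := Λ.relDense
    refine ⟨R, hR, fun y => ?_⟩
    obtain ⟨p, hp, hpy⟩ := h (y + x)
    refine ⟨(p.1 - x, p.2), by simpa using hp, ?_⟩
    rw [← dist_add_right _ _ x]
    simpa using hpy

theorem mem_sub {Λ : LabeledDelone d X} {x : Euc d} {p : Euc d × X} :
    p ∈ (Λ.sub x).carrier ↔ (p.1 + x, p.2) ∈ Λ.carrier := Iff.rfl

theorem sub_zero (Λ : LabeledDelone d X) : Λ.sub 0 = Λ := by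
  ext p; simp [mem_sub]

theorem sub_sub (Λ : LabeledDelone d X) (x y : Euc d) : (Λ.sub x).sub y = Λ.sub (x + y) := by
  ext p; simp [mem_sub, add_assoc, add_comm x y]

/-- The orbit of `Λ` under translations. -/
def orbit (Λ : LabeledDelone d X) : Set (LabeledDelone d X) := Set.range Λ.sub

/-- The patch `Λ ∩ B(x, R)`: all labelled points whose position is at distance `< R` of `x`. -/
def patch (Λ : LabeledDelone d X) (x : Euc d) (R : ℝ) : Set (Euc d × X) :=
  {p | p ∈ Λ.carrier ∧ dist p.1 x < R}

theorem patch_finite (Λ : LabeledDelone d X) (x : Euc d) (R : ℝ) : (Λ.patch x R).Finite := by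
  obtain ⟨r, hr, h⟩ := Λ.separated
  have hinj : Set.InjOn Prod.fst Λ.carrier := by
    intro p hp q hq e
    by_contra hne
    have := h p hp q hq hne
    rw [e, dist_self] at this
    linarith
  have hpw : (Prod.fst '' Λ.carrier).Pairwise fun a b => r ≤ dist a b := by
    rintro _ ⟨p, hp, rfl⟩ _ ⟨q, hq, rfl⟩ hne
    exact h p hp q hq (fun e => hne (by rw [e]))
  have hcl : IsClosed (Prod.fst '' Λ.carrier) := Metric.isClosed_of_pairwise_le_dist hr hpw
  have hdisc : IsDiscrete (Prod.fst '' Λ.carrier) := by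
    refine ⟨DiscreteTopology.of_forall_le_dist hr ?_⟩
    intro a b hab
    exact hpw a.2 b.2 (fun e => hab (Subtype.ext e))
  have hfin := Metric.finite_isBounded_inter_isClosed hdisc (Metric.isBounded_ball (x := x) (r := R))
    hcl
  refine Set.Finite.of_finite_image (f := Prod.fst) (hfin.subset ?_)
    (hinj.mono fun p hp => hp.1)
  rintro _ ⟨p, hp, rfl⟩
  exact ⟨hp.2, p, hp.1, rfl⟩

theorem countable_carrier (T : LabeledDelone d X) : T.carrier.Countable := by
  refine (Set.countable_iUnion fun n : ℕ => (T.patch_finite 0 n).countable).mono ?_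
  intro p hp
  obtain ⟨n, hn⟩ := exists_nat_gt (dist p.1 0)
  exact Set.mem_iUnion.2 ⟨n, hp, hn⟩

variable [MetricSpace X]

/-- `Λ` and `Λ'` are `ε`-close: there is a one-to-one correspondence `M` between some points of `Λ`
and some points of `Λ'`, which involves at least all points of both sets of norm `< 1/ε`, such that
corresponding points have `ε`-close positions and `ε`-close labels. (The distance on
`Euc d × X` is the maximum of the two distances.) -/
def Near (ε : ℝ) (Λ Λ' : LabeledDelone d X) : Prop :=
  ∃ M : Euc d × X → Euc d × X → Prop,
    (∀ p q, M p q → p ∈ Λ.carrier ∧ q ∈ Λ'.carrier ∧ dist p q < ε) ∧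
    Relator.BiUnique M ∧
    (∀ p ∈ Λ.carrier, ‖p.1‖ < ε⁻¹ → ∃ q, M p q) ∧
    (∀ q ∈ Λ'.carrier, ‖q.1‖ < ε⁻¹ → ∃ p, M p q)

theorem Near.mono {δ ε : ℝ} (hδ : 0 < δ) (h : δ ≤ ε) {Λ Λ' : LabeledDelone d X}
    (H : Near δ Λ Λ') : Near ε Λ Λ' := by
  obtain ⟨M, h1, h2, h3, h4⟩ := H
  have hi : ε⁻¹ ≤ δ⁻¹ := inv_anti₀ hδ h
  exact ⟨M, fun p q hM => ⟨(h1 p q hM).1, (h1 p q hM).2.1, (h1 p q hM).2.2.trans_le h⟩, h2,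
    fun p hp hn => h3 p hp (hn.trans_le hi), fun q hq hn => h4 q hq (hn.trans_le hi)⟩

theorem Near.refl {ε : ℝ} (hε : 0 < ε) (Λ : LabeledDelone d X) : Near ε Λ Λ := by
  refine ⟨fun p q => p = q ∧ p ∈ Λ.carrier, ?_, ⟨?_, ?_⟩, ?_, ?_⟩
  · rintro p q ⟨rfl, hp⟩
    exact ⟨hp, hp, by simpa using hε⟩
  · rintro p q s ⟨rfl, -⟩ ⟨rfl, -⟩; rfl
  · rintro p q s ⟨rfl, -⟩ ⟨rfl, -⟩; rfl
  · exact fun p hp _ => ⟨p, rfl, hp⟩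
  · exact fun p hp _ => ⟨p, rfl, hp⟩

theorem Near.symm {ε : ℝ} {Λ Λ' : LabeledDelone d X} (H : Near ε Λ Λ') : Near ε Λ' Λ := by
  obtain ⟨M, h1, h2, h3, h4⟩ := H
  refine ⟨fun p q => M q p, fun p q hM => ?_, ⟨?_, ?_⟩, h4, h3⟩
  · obtain ⟨a, b, c⟩ := h1 q p hM
    exact ⟨b, a, by rwa [dist_comm]⟩
  · intro p q s hp hq; exact h2.2 hp hq
  · intro p q s hp hq; exact h2.1 hp hq

theorem Near.comp {ε δ : ℝ} (h2 : δ + δ ≤ ε) (hi : ε⁻¹ + δ ≤ δ⁻¹) (hδ : 0 < δ)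
    {Λ Λ' Λ'' : LabeledDelone d X} (H : Near δ Λ Λ') (H' : Near δ Λ' Λ'') : Near ε Λ Λ'' := by
  obtain ⟨M, a1, a2, a3, a4⟩ := H
  obtain ⟨N, b1, b2, b3, b4⟩ := H'
  refine ⟨fun p s => ∃ q, M p q ∧ N q s, ?_, ⟨?_, ?_⟩, ?_, ?_⟩
  · rintro p s ⟨q, hM, hN⟩
    refine ⟨(a1 _ _ hM).1, (b1 _ _ hN).2.1, ?_⟩
    linarith [dist_triangle p q s, (a1 _ _ hM).2.2, (b1 _ _ hN).2.2]
  · rintro p q s ⟨t, hM, hN⟩ ⟨t', hM', hN'⟩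
    have := b2.1 hN hN'
    subst this
    exact a2.1 hM hM'
  · rintro p q s ⟨t, hM, hN⟩ ⟨t', hM', hN'⟩
    have := a2.2 hM hM'
    subst this
    exact b2.2 hN hN'
  · intro p hp hn
    obtain ⟨q, hM⟩ := a3 p hp (by linarith)
    obtain ⟨-, hq, hd⟩ := a1 _ _ hM
    have hd' : dist p.1 q.1 < δ := (le_max_left _ _).trans_lt hd
    have : ‖q.1‖ ≤ ‖p.1‖ + dist p.1 q.1 := by
      rw [dist_comm, dist_eq_norm]
      linarith [norm_sub_norm_le q.1 p.1]
    obtain ⟨s, hN⟩ := b3 q hq (by linarith)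
    exact ⟨s, q, hM, hN⟩
  · intro s hs hn
    obtain ⟨q, hN⟩ := b4 s hs (by linarith)
    obtain ⟨hq, -, hd⟩ := b1 _ _ hN
    have hd' : dist q.1 s.1 < δ := (le_max_left _ _).trans_lt hd
    have : ‖q.1‖ ≤ ‖s.1‖ + dist q.1 s.1 := by
      rw [dist_eq_norm]
      linarith [norm_sub_norm_le q.1 s.1]
    obtain ⟨p, hM⟩ := a4 q hq (by linarith)
    exact ⟨p, q, hM, hN⟩

theorem exists_comp_radius {ε : ℝ} (hε : 0 < ε) :
    ∃ δ : ℝ, 0 < δ ∧ δ + δ ≤ ε ∧ ε⁻¹ + δ ≤ δ⁻¹ := by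
  have h0 : 0 < ε⁻¹ := inv_pos.2 hε
  refine ⟨min (ε / 2) (ε⁻¹ + 1)⁻¹, by positivity, ?_, ?_⟩
  · linarith [min_le_left (ε / 2) (ε⁻¹ + 1)⁻¹]
  · have h1 : min (ε / 2) (ε⁻¹ + 1)⁻¹ ≤ (ε⁻¹ + 1)⁻¹ := min_le_right _ _
    have h2 : (ε⁻¹ + 1)⁻¹ ≤ 1 := inv_le_one_of_one_le₀ (by linarith)
    have h3 : ε⁻¹ + 1 ≤ (min (ε / 2) (ε⁻¹ + 1)⁻¹)⁻¹ := by
      rw [le_inv_comm₀ (by positivity) (by positivity)]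
      exact h1
    linarith

/-- The sets of `ε`-close pairs form a basis of the uniform structure. -/
def nearBasis (d : ℕ) (X : Type*) [MetricSpace X] :
    FilterBasis (LabeledDelone d X × LabeledDelone d X) where
  sets := {S | ∃ ε : ℝ, 0 < ε ∧ S = {P | Near ε P.1 P.2}}
  nonempty := ⟨_, 1, one_pos, rfl⟩
  inter_sets := by
    rintro _ _ ⟨ε, hε, rfl⟩ ⟨δ, hδ, rfl⟩
    refine ⟨_, ⟨min ε δ, lt_min hε hδ, rfl⟩, fun P hP => ⟨?_, ?_⟩⟩
    · exact Near.mono (lt_min hε hδ) (min_le_left _ _) hP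
    · exact Near.mono (lt_min hε hδ) (min_le_right _ _) hP

/-- The topology (and uniform structure) on labelled Delone sets for which the sets `ε`-close to
`Λ`, `ε > 0`, are a basis of neighbourhoods of `Λ`. -/
instance instUniformSpace : UniformSpace (LabeledDelone d X) :=
  UniformSpace.ofCore <| UniformSpace.Core.mkOfBasis (nearBasis d X)
    (by rintro _ ⟨ε, hε, rfl⟩ Λ; exact Near.refl hε Λ)
    (by rintro _ ⟨ε, hε, rfl⟩; exact ⟨_, ⟨ε, hε, rfl⟩, fun P hP => Near.symm hP⟩)
    (by
      rintro _ ⟨ε, hε, rfl⟩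
      obtain ⟨δ, h0, h1, h2⟩ := exists_comp_radius hε
      refine ⟨_, ⟨δ, h0, rfl⟩, ?_⟩
      rintro ⟨Λ, Λ''⟩ ⟨Λ', hP, hQ⟩
      exact Near.comp h1 h2 h0 hP hQ)

theorem hasBasis_nhds (Λ : LabeledDelone d X) :
    (𝓝 Λ).HasBasis (fun ε : ℝ => 0 < ε) (fun ε => {Λ' | Near ε Λ Λ'}) := by
  have hu : (uniformity (LabeledDelone d X)).HasBasis (fun ε : ℝ => 0 < ε)
      (fun ε => {P | Near ε P.1 P.2}) := by
    refine ⟨fun t => ?_⟩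
    change t ∈ (nearBasis d X).filter ↔ _
    rw [FilterBasis.mem_filter_iff]
    constructor
    · rintro ⟨_, ⟨ε, hε, rfl⟩, h⟩; exact ⟨ε, hε, h⟩
    · rintro ⟨ε, hε, h⟩; exact ⟨_, ⟨ε, hε, rfl⟩, h⟩
  exact nhds_basis_uniformity' hu

instance : T0Space (LabeledDelone d X) := by
  have key : ∀ Λ Λ' : LabeledDelone d X, (∀ ε : ℝ, 0 < ε → Near ε Λ Λ') →
      Λ.carrier ⊆ Λ'.carrier := by
    intro Λ Λ' H p hp
    obtain ⟨r, hr, hsep⟩ := Λ'.separated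
    have h1 : ∀ ε : ℝ, 0 < ε → ∃ q ∈ Λ'.carrier, dist p q < ε := by
      intro ε hε
      have h0 : 0 < (‖p.1‖ + 1)⁻¹ := by positivity
      obtain ⟨M, a1, -, a3, -⟩ := H (min ε (‖p.1‖ + 1)⁻¹) (lt_min hε h0)
      obtain ⟨q, hq⟩ := a3 p hp (by
        have : ‖p.1‖ + 1 ≤ (min ε (‖p.1‖ + 1)⁻¹)⁻¹ := by
          rw [le_inv_comm₀ (by positivity) (lt_min hε h0)]
          exact min_le_right _ _
        linarith)
      exact ⟨q, (a1 _ _ hq).2.1, (a1 _ _ hq).2.2.trans_le (min_le_left _ _)⟩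
    obtain ⟨q, hq, hpq⟩ := h1 (r / 2) (by positivity)
    have h2 : ∀ ε : ℝ, 0 < ε → dist p q < ε := by
      intro ε hε
      obtain ⟨s, hs, hps⟩ := h1 (min ε (r / 2)) (lt_min hε (by positivity))
      have : s = q := by
        by_contra hne
        have h3 := hsep s hs q hq hne
        have h4 : dist s.1 q.1 ≤ dist s q := le_max_left _ _
        have h5 := dist_triangle_left s q p
        linarith [hps.trans_le (min_le_right _ _)]
      rw [this] at hps
      exact hps.trans_le (min_le_left _ _)
    have : dist p q = 0 := le_antisymm
      (le_of_forall_pos_le_add fun ε hε => by linarith [h2 ε hε]) dist_nonneg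
    rwa [dist_eq_zero.1 this]
  refine ⟨fun Λ Λ' h => ?_⟩
  have hn : ∀ ε : ℝ, 0 < ε → Near ε Λ Λ' := by
    intro ε hε
    have h1 : {Λ'' | Near ε Λ Λ''} ∈ 𝓝 Λ' := by
      rw [← h.nhds_eq]
      exact (hasBasis_nhds Λ).mem_of_mem hε
    exact (mem_of_mem_nhds h1 : Λ' ∈ {Λ'' | Near ε Λ Λ''})
  exact LabeledDelone.ext (Set.Subset.antisymm (key _ _ hn)
    (key _ _ fun ε hε => (hn ε hε).symm))

theorem continuous_sub : Continuous fun P : LabeledDelone d X × Euc d => P.1.sub P.2 := by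
  rw [continuous_iff_continuousAt]
  rintro ⟨Λ, x⟩
  rw [ContinuousAt, (hasBasis_nhds _).tendsto_right_iff]
  intro ε hε
  have h0 : 0 < (ε⁻¹ + ‖x‖ + 1)⁻¹ := by positivity
  obtain ⟨δ, hδ0, hδ1, hδ2, hδ3⟩ : ∃ δ : ℝ, 0 < δ ∧ δ + δ ≤ ε ∧ δ ≤ 1 ∧
      ε⁻¹ + ‖x‖ + 1 ≤ δ⁻¹ := by
    refine ⟨min (min (ε / 2) 1) (ε⁻¹ + ‖x‖ + 1)⁻¹, by positivity, ?_, ?_, ?_⟩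
    · linarith [min_le_left (min (ε / 2) 1) (ε⁻¹ + ‖x‖ + 1)⁻¹, min_le_left (ε / 2) 1]
    · exact (min_le_left _ _).trans (min_le_right _ _)
    · rw [le_inv_comm₀ (by positivity) (by positivity)]
      exact min_le_right _ _
  have hN : ∀ᶠ P : LabeledDelone d X × Euc d in 𝓝 (Λ, x), Near δ Λ P.1 ∧ dist P.2 x < δ := by
    rw [nhds_prod_eq]
    exact Filter.prod_mem_prod ((hasBasis_nhds Λ).mem_of_mem hδ0) (Metric.ball_mem_nhds x hδ0)
  filter_upwards [hN]
  rintro ⟨Λ', x'⟩ ⟨⟨M, a1, a2, a3, a4⟩, hx⟩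
  simp only at a1 a4 hx ⊢
  have hx' : ‖x'‖ ≤ ‖x‖ + δ := by
    rw [dist_eq_norm] at hx
    linarith [norm_sub_norm_le x' x]
  refine ⟨fun p q => M (p.1 + x, p.2) (q.1 + x', q.2), ?_, ⟨?_, ?_⟩, ?_, ?_⟩
  · intro p q hM
    obtain ⟨h1, h2, h3⟩ := a1 _ _ hM
    refine ⟨h1, h2, max_lt ?_ ?_⟩
    · have h4 : dist (p.1 + x) (q.1 + x') < δ := (le_max_left _ _).trans_lt h3
      have h5 : dist p.1 q.1 ≤ dist (p.1 + x) (q.1 + x') + dist x' x := by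
        rw [← dist_add_right p.1 q.1 x]
        refine (dist_triangle _ (q.1 + x') _).trans ?_
        simp
      linarith
    · have h4 : dist p.2 q.2 < δ := (le_max_right _ _).trans_lt h3
      linarith
  · intro p q s hp hq
    have := a2.1 hp hq
    simp only [Prod.mk.injEq, add_left_inj] at this
    exact Prod.ext this.1 this.2
  · intro p q s hp hq
    have := a2.2 hp hq
    simp only [Prod.mk.injEq, add_left_inj] at this
    exact Prod.ext this.1 this.2
  · intro p hp hn
    obtain ⟨q, hq⟩ := a3 _ hp (by
      change ‖p.1 + x‖ < _
      linarith [norm_add_le p.1 x])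
    exact ⟨(q.1 - x', q.2), by simpa using hq⟩
  · intro q hq hn
    obtain ⟨p, hp⟩ := a4 _ hq (by
      change ‖q.1 + x'‖ < _
      linarith [norm_add_le q.1 x'])
    exact ⟨(p.1 - x, p.2), by simpa using hp⟩

/-- The hull of `Λ`: the closure of its orbit. -/
def hull (Λ : LabeledDelone d X) : Set (LabeledDelone d X) := closure Λ.orbit

end LabeledDelone

/-- A minimal aperiodic tiling space: a nonempty set of labelled Delone sets which is the hull of
each of its elements (so it is the hull of a labelled Delone set, and every orbit in it is dense)
and none of whose elements has a nonzero period. -/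
structure TilingSpace (d : ℕ) (X : Type*) [MetricSpace X] where
  carrier : Set (LabeledDelone d X)
  nonempty : carrier.Nonempty
  hull_eq : ∀ Λ ∈ carrier, Λ.hull = carrier
  aperiodic : ∀ Λ ∈ carrier, ∀ x : Euc d, Λ.sub x = Λ → x = 0

namespace TilingSpace

variable {d : ℕ} {X : Type*} [MetricSpace X] {X' : Type*} [MetricSpace X']

instance : CoeSort (TilingSpace d X) (Type _) := ⟨fun Ω => Ω.carrier⟩

/-- The translation action `(T, x) ↦ T - x` on a tiling space. -/
def sub {Ω : TilingSpace d X} (T : Ω) (x : Euc d) : Ω :=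
  ⟨T.1.sub x, (Ω.hull_eq T.1 T.2).subset (subset_closure ⟨x, rfl⟩)⟩

theorem sub_zero {Ω : TilingSpace d X} (T : Ω) : sub T 0 = T :=
  Subtype.ext (LabeledDelone.sub_zero _)

theorem sub_sub {Ω : TilingSpace d X} (T : Ω) (x y : Euc d) : sub (sub T x) y = sub T (x + y) :=
  Subtype.ext (LabeledDelone.sub_sub _ _ _)

theorem sub_injective {Ω : TilingSpace d X} (T : Ω) {x y : Euc d} (h : sub T x = sub T y) :
    x = y := by
  have h1 : sub (sub T y) (x - y) = sub T y := by
    rw [sub_sub, add_sub_cancel, h]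
  exact sub_eq_zero.1 (Ω.aperiodic _ (sub T y).2 _ (congrArg Subtype.val h1))

theorem continuous_sub {Ω : TilingSpace d X} : Continuous fun P : Ω × Euc d => sub P.1 P.2 :=
  (LabeledDelone.continuous_sub.comp
    ((continuous_subtype_val.comp continuous_fst).prodMk continuous_snd)).subtype_mk _

/-- Finite local complexity: for each `R`, the patches of radius `R` occurring in the space
are, up to translation, finitely many. -/
def FLC (Ω : TilingSpace d X) : Prop :=
  ∀ R : ℝ, ∃ F : Set (Set (Euc d × X)), F.Finite ∧
    ∀ (T : Ω) (x : Euc d), ∃ y : Euc d,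
      (fun p : Euc d × X => (p.1 - y, p.2)) '' T.1.patch x R ∈ F

/-- `h` maps every orbit into an orbit. -/
def OrbitPreserving {Ω : TilingSpace d X} {Ω' : TilingSpace d X'} (h : Ω → Ω') : Prop :=
  ∀ (T : Ω) (v : Euc d), ∃ w : Euc d, h (sub T v) = sub (h T) w

/-- A homeomorphism `h` is an orbit equivalence if the image of every orbit is an orbit:
two elements lie in the same orbit if and only if their images do. -/
def IsOrbitEquivalence {Ω : TilingSpace d X} {Ω' : TilingSpace d X'} (h : Ω ≃ₜ Ω') : Prop :=
  ∀ T T' : Ω, (∃ v : Euc d, T' = sub T v) ↔ ∃ w : Euc d, h T' = sub (h T) w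

theorem IsOrbitEquivalence.orbitPreserving {Ω : TilingSpace d X} {Ω' : TilingSpace d X'}
    {h : Ω ≃ₜ Ω'} (hh : IsOrbitEquivalence h) : OrbitPreserving (h : C(Ω, Ω')) :=
  fun T v => (hh T (sub T v)).1 ⟨v, rfl⟩

/-- A factor map: a continuous map with `φ (T - x) = φ T - x`. -/
def IsFactorMap {Ω : TilingSpace d X} {Ω' : TilingSpace d X'} (φ : C(Ω, Ω')) : Prop :=
  ∀ (T : Ω) (x : Euc d), φ (sub T x) = sub (φ T) x

/-- A local map: `φ T ∩ B(0, r)` is determined by `T ∩ B(0, R)`, with `R` depending on `r`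
only. -/
def IsLocalMap {Ω : TilingSpace d X} {Ω' : TilingSpace d X'} (φ : C(Ω, Ω')) : Prop :=
  ∀ r : ℝ, 0 < r → ∃ R : ℝ, 0 < R ∧ ∀ T T' : Ω,
    T.1.patch 0 R = T'.1.patch 0 R → (φ T).1.patch 0 r = (φ T').1.patch 0 r

/-- A local derivation: a local map that is also a factor map. -/
def IsLocalDerivation {Ω : TilingSpace d X} {Ω' : TilingSpace d X'} (φ : C(Ω, Ω')) : Prop :=
  IsLocalMap φ ∧ IsFactorMap φ

/-! ### Positions of points as local functions -/

theorem exists_radius (Ω : TilingSpace d X) : ∃ ρ : ℝ, 0 < ρ ∧ ∀ T : Ω,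
    ∀ p ∈ T.1.carrier, ∀ q ∈ T.1.carrier, p ≠ q → 2 * ρ ≤ dist p.1 q.1 := by
  obtain ⟨Λ, hΛ⟩ := Ω.nonempty
  obtain ⟨r, hr, hsep⟩ := Λ.separated
  refine ⟨r / 4, by positivity, fun T p hp q hq hne => ?_⟩
  have hT : T.1 ∈ closure Λ.orbit := (Ω.hull_eq Λ hΛ).symm.subset T.2
  set N := ‖p.1‖ + ‖q.1‖ + 1 with hN
  have hN0 : 0 < N := by positivity
  obtain ⟨δ, hδ0, hδ1, hδ2⟩ : ∃ δ : ℝ, 0 < δ ∧ δ ≤ r / 4 ∧ N ≤ δ⁻¹ := by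
    refine ⟨min (r / 4) N⁻¹, by positivity, min_le_left _ _, ?_⟩
    rw [le_inv_comm₀ (by positivity) (by positivity)]
    exact min_le_right _ _
  obtain ⟨_, ⟨M, a1, a2, a3, -⟩, ⟨x, rfl⟩⟩ :=
    mem_closure_iff_nhds.1 hT _ ((LabeledDelone.hasBasis_nhds T.1).mem_of_mem hδ0)
  obtain ⟨p', hp'⟩ := a3 p hp (by linarith [norm_nonneg q.1])
  obtain ⟨q', hq'⟩ := a3 q hq (by linarith [norm_nonneg p.1])
  have hne' : p' ≠ q' := by
    rintro rfl
    exact hne (a2.1 hp' hq')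
  obtain ⟨-, hp1, hp2⟩ := a1 _ _ hp'
  obtain ⟨-, hq1, hq2⟩ := a1 _ _ hq'
  have h1 := hsep _ hp1 _ hq1 (fun e => hne' (by
    simp only [Prod.mk.injEq, add_left_inj] at e
    exact Prod.ext e.1 e.2))
  simp only [dist_add_right] at h1
  have h2 : dist p.1 p'.1 < δ := (le_max_left _ _).trans_lt hp2
  have h3 : dist q.1 q'.1 < δ := (le_max_left _ _).trans_lt hq2
  have h4 := dist_triangle4 p'.1 p.1 q.1 q'.1
  rw [dist_comm p'.1 p.1] at h4
  linarith

/-- A radius `ρ > 0` such that distinct points of any element of the space are at distance at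
least `2ρ`. -/
noncomputable def radius (Ω : TilingSpace d X) : ℝ := Classical.choose Ω.exists_radius

theorem radius_pos (Ω : TilingSpace d X) : 0 < Ω.radius := (Classical.choose_spec Ω.exists_radius).1

theorem radius_spec (Ω : TilingSpace d X) (T : Ω) {p q : Euc d × X} (hp : p ∈ T.1.carrier)
    (hq : q ∈ T.1.carrier) (h : dist p.1 q.1 < 2 * Ω.radius) : p = q := by
  by_contra hne
  exact absurd ((Classical.choose_spec Ω.exists_radius).2 T p hp q hq hne) (not_le.2 h)

/-- The elements of `Ω` with a (necessarily unique) point in the ball of centre `x` and radius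
`Ω.radius`. -/
def cell (Ω : TilingSpace d X) (x : Euc d) : Set Ω :=
  {T | ∃ p ∈ T.1.carrier, dist p.1 x < Ω.radius}

open Classical in
/-- For `T` in `Ω.cell x`, the position of the point of `T` in the ball of centre `x` and radius
`Ω.radius` (and `0` elsewhere). -/
noncomputable def pos (Ω : TilingSpace d X) (x : Euc d) (T : Ω) : Euc d :=
  if h : T ∈ Ω.cell x then (Classical.choose h).1 else 0

theorem pos_eq (Ω : TilingSpace d X) {x : Euc d} {T : Ω} {p : Euc d × X} (hp : p ∈ T.1.carrier)
    (hx : dist p.1 x < Ω.radius) : Ω.pos x T = p.1 := by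
  have h : T ∈ Ω.cell x := ⟨p, hp, hx⟩
  rw [pos, dif_pos h]
  obtain ⟨h1, h2⟩ := Classical.choose_spec h
  rw [Ω.radius_spec T h1 hp (by linarith [dist_triangle_right (Classical.choose h).1 p.1 x])]

theorem exists_pos (Ω : TilingSpace d X) {x : Euc d} {T : Ω} (h : T ∈ Ω.cell x) :
    ∃ l : X, (Ω.pos x T, l) ∈ T.1.carrier ∧ dist (Ω.pos x T) x < Ω.radius := by
  obtain ⟨p, hp, hx⟩ := h
  rw [Ω.pos_eq hp hx]
  exact ⟨p.2, hp, hx⟩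

theorem exists_cell (Ω : TilingSpace d X) (T : Ω) : ∃ x, T ∈ Ω.cell x := by
  obtain ⟨R, -, h⟩ := T.1.relDense
  obtain ⟨p, hp, -⟩ := h 0
  exact ⟨p.1, p, hp, by simpa using Ω.radius_pos⟩

theorem eventually_pos (Ω : TilingSpace d X) {x : Euc d} {T : Ω} (h : T ∈ Ω.cell x) {ε : ℝ}
    (hε : 0 < ε) : ∀ᶠ T' in 𝓝 T, T' ∈ Ω.cell x ∧ dist (Ω.pos x T') (Ω.pos x T) < ε := by
  obtain ⟨p, hp, hx⟩ := h
  rw [Ω.pos_eq hp hx]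
  have hN0 : 0 < ‖p.1‖ + 1 := by positivity
  have hg : 0 < Ω.radius - dist p.1 x := by linarith
  obtain ⟨δ, hδ0, hδ1, hδ2, hδ3⟩ : ∃ δ : ℝ, 0 < δ ∧ δ ≤ ε ∧ δ ≤ Ω.radius - dist p.1 x ∧
      ‖p.1‖ + 1 ≤ δ⁻¹ := by
    refine ⟨min (min ε (Ω.radius - dist p.1 x)) (‖p.1‖ + 1)⁻¹, ?_, ?_, ?_, ?_⟩
    · exact lt_min (lt_min hε hg) (by positivity)
    · exact (min_le_left _ _).trans (min_le_left _ _)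
    · exact (min_le_left _ _).trans (min_le_right _ _)
    · rw [le_inv_comm₀ (by positivity) (lt_min (lt_min hε hg) (by positivity))]
      exact min_le_right _ _
  have hev : ∀ᶠ T' : Ω in 𝓝 T, LabeledDelone.Near δ T.1 T'.1 :=
    continuous_subtype_val.continuousAt.eventually
      ((LabeledDelone.hasBasis_nhds T.1).mem_of_mem hδ0)
  filter_upwards [hev]
  rintro T' ⟨M, a1, -, a3, -⟩
  obtain ⟨q, hq⟩ := a3 p hp (by linarith)
  obtain ⟨-, hq1, hq2⟩ := a1 _ _ hq
  have h1 : dist p.1 q.1 < δ := (le_max_left _ _).trans_lt hq2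
  have h2 : dist q.1 x < Ω.radius := by
    linarith [dist_triangle_left q.1 x p.1]
  refine ⟨⟨q, hq1, h2⟩, ?_⟩
  rw [Ω.pos_eq hq1 h2, dist_comm]
  linarith

theorem isOpen_cell (Ω : TilingSpace d X) (x : Euc d) : IsOpen (Ω.cell x) :=
  isOpen_iff_mem_nhds.2 fun _ hT => (Ω.eventually_pos hT one_pos).mono fun _ h => h.1

theorem continuousAt_pos (Ω : TilingSpace d X) {x : Euc d} {T : Ω} (h : T ∈ Ω.cell x) :
    ContinuousAt (Ω.pos x) T :=
  Metric.tendsto_nhds.2 fun _ hε => (Ω.eventually_pos h hε).mono fun _ h => h.2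

theorem FLC.eventually_eq {Ω : TilingSpace d X} (hΩ : Ω.FLC) {x y : Euc d} {T : Ω}
    (hx : T ∈ Ω.cell x) (hy : T ∈ Ω.cell y) :
    ∀ᶠ T' in 𝓝 T, Ω.pos x T' - Ω.pos y T' = Ω.pos x T - Ω.pos y T := by
  obtain ⟨F, hF, hP⟩ := hΩ (2 * Ω.radius + dist x y)
  set D : Set (Euc d) := ⋃ P ∈ {P ∈ F | P.Finite}, (fun a : (Euc d × X) × (Euc d × X) =>
    a.1.1 - a.2.1) '' (P ×ˢ P) with hD
  have hDfin : D.Finite :=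
    (hF.subset (Set.sep_subset _ _)).biUnion fun P hP => (hP.2.prod hP.2).image _
  have hmem : ∀ T' : Ω, T' ∈ Ω.cell x → T' ∈ Ω.cell y → Ω.pos x T' - Ω.pos y T' ∈ D := by
    intro T' h1 h2
    obtain ⟨l, hl, hlx⟩ := Ω.exists_pos h1
    obtain ⟨m, hm, hmy⟩ := Ω.exists_pos h2
    obtain ⟨z, hz⟩ := hP T' x
    refine Set.mem_biUnion (x := (fun p : Euc d × X => (p.1 - z, p.2)) ''
      T'.1.patch x (2 * Ω.radius + dist x y))
      ⟨hz, (LabeledDelone.patch_finite _ _ _).image _⟩ ?_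
    refine ⟨((Ω.pos x T' - z, l), (Ω.pos y T' - z, m)), ⟨?_, ?_⟩, by simp⟩
    · exact ⟨(Ω.pos x T', l), ⟨hl, by
        change dist (Ω.pos x T') x < _
        linarith [Ω.radius_pos, dist_nonneg (x := x) (y := y)]⟩, rfl⟩
    · exact ⟨(Ω.pos y T', m), ⟨hm, by
        change dist (Ω.pos y T') x < _
        linarith [Ω.radius_pos, dist_triangle_right (Ω.pos y T') x y]⟩, rfl⟩
  have hcont : ContinuousAt (fun T' => Ω.pos x T' - Ω.pos y T') T :=
    (Ω.continuousAt_pos hx).sub (Ω.continuousAt_pos hy)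
  have hne : ∀ᶠ T' in 𝓝 T, Ω.pos x T' - Ω.pos y T' ∈ (D \ {Ω.pos x T - Ω.pos y T})ᶜ :=
    hcont.eventually ((hDfin.subset Set.sdiff_subset).isClosed.isOpen_compl.mem_nhds (by simp))
  filter_upwards [hne, (Ω.isOpen_cell x).mem_nhds hx, (Ω.isOpen_cell y).mem_nhds hy]
    with T' h1 h2 h3
  by_contra h4
  exact h1 ⟨hmem T' h2 h3, h4⟩

/-! ### Weak cohomology and the weak class of an orbit-preserving map -/

/-- The group of weak dynamical `1`-cocycles with values in `ℝ^d`: continuous functions `α` with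
`α(T, x) + α(T - x, y) = α(T, x + y)`. -/
def weakCocycles (Ω : TilingSpace d X) : AddSubgroup C(Ω × Euc d, Euc d) where
  carrier := {α | ∀ (T : Ω) (x y : Euc d), α (T, x) + α (sub T x, y) = α (T, x + y)}
  zero_mem' := by intro T x y; simp
  add_mem' := by
    intro α β hα hβ T x y
    simp only [ContinuousMap.add_apply]
    rw [← hα T x y, ← hβ T x y]
    abel
  neg_mem' := by
    intro α hα T x y
    simp only [ContinuousMap.neg_apply]
    rw [← hα T x y]
    abel

/-- The coboundary `δs(T, v) = s(T - v) - s(T)` of a continuous function `s`. -/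
def weakCoboundary (Ω : TilingSpace d X) : C(Ω, Euc d) →+ Ω.weakCocycles where
  toFun s := ⟨⟨fun P => s (sub P.1 P.2) - s P.1,
      (s.continuous.comp continuous_sub).sub (s.continuous.comp continuous_fst)⟩, by
    intro T x y
    simp only [ContinuousMap.coe_mk, sub_sub]
    abel⟩
  map_zero' := by ext P; simp
  map_add' s t := by
    apply Subtype.ext
    ext1 P
    simp only [ContinuousMap.coe_mk, ContinuousMap.add_apply, AddSubgroup.coe_add]
    abel

/-- The weak cohomology group `H¹_w(Ω; ℝ^d)`. -/
abbrev WeakH1 (Ω : TilingSpace d X) : Type _ := Ω.weakCocycles ⧸ Ω.weakCoboundary.range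

/-- The function `(T, v) ↦ h_T(v)` of an orbit-preserving map, given by
`h(T - v) = h(T) - h_T(v)`. -/
noncomputable def displacement {Ω : TilingSpace d X} {Ω' : TilingSpace d X'} {h : Ω → Ω'}
    (hh : OrbitPreserving h) (T : Ω) (v : Euc d) : Euc d := Classical.choose (hh T v)

theorem displacement_spec {Ω : TilingSpace d X} {Ω' : TilingSpace d X'} {h : Ω → Ω'}
    (hh : OrbitPreserving h) (T : Ω) (v : Euc d) :
    h (sub T v) = sub (h T) (displacement hh T v) := Classical.choose_spec (hh T v)

theorem displacement_add {Ω : TilingSpace d X} {Ω' : TilingSpace d X'} {h : Ω → Ω'}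
    (hh : OrbitPreserving h) (T : Ω) (x y : Euc d) :
    displacement hh T x + displacement hh (sub T x) y = displacement hh T (x + y) := by
  apply sub_injective (h T)
  rw [← sub_sub, ← displacement_spec hh T x, ← displacement_spec hh (sub T x) y, sub_sub,
    displacement_spec hh T (x + y)]

theorem displacement_zero {Ω : TilingSpace d X} {Ω' : TilingSpace d X'} {h : Ω → Ω'}
    (hh : OrbitPreserving h) (T : Ω) : displacement hh T 0 = 0 := by
  apply sub_injective (h T)
  rw [← displacement_spec hh T 0, sub_zero, sub_zero]

/-- Near `(T₀, v₀)`, the displacement is the negative of the position of a point of `h(T - v)`, up to a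
constant depending on `T`. -/
theorem displacement_local {Ω : TilingSpace d X} {Ω' : TilingSpace d X'} {h : C(Ω, Ω')}
    (hh : OrbitPreserving h) (T₀ : Ω) (v₀ : Euc d) : ∃ x : Euc d, ∃ δ : ℝ, 0 < δ ∧
      h (sub T₀ v₀) ∈ Ω'.cell x ∧ ∀ᶠ T in 𝓝 T₀, ∀ v ∈ Metric.ball v₀ δ,
        h (sub T v) ∈ Ω'.cell x ∧ displacement hh T v =
          displacement hh T v₀ + Ω'.pos x (h (sub T v₀)) - Ω'.pos x (h (sub T v)) := by
  obtain ⟨x, hx⟩ := Ω'.exists_cell (h (sub T₀ v₀))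
  have hc : Continuous fun P : Ω × Euc d => h (sub P.1 P.2) := h.continuous.comp continuous_sub
  have hev : ∀ᶠ P : Ω × Euc d in 𝓝 (T₀, v₀), h (sub P.1 P.2) ∈ Ω'.cell x :=
    hc.continuousAt.eventually ((Ω'.isOpen_cell x).mem_nhds hx)
  rw [nhds_prod_eq] at hev
  obtain ⟨P, hP, Q, hQ, hPQ⟩ := Filter.eventually_prod_iff.1 hev
  obtain ⟨δ, hδ, hball⟩ := Metric.eventually_nhds_iff_ball.1 hQ
  refine ⟨x, δ, hδ, hx, hP.mono fun T hT v hv => ?_⟩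
  have hcell : ∀ w ∈ Metric.ball v₀ δ, h (sub T w) ∈ Ω'.cell x :=
    fun w hw => hPQ hT (hball w hw)
  refine ⟨hcell v hv, ?_⟩
  -- the position, in `h T`, of the chosen point of `h (T - w)`
  let m : Euc d → Euc d := fun w => Ω'.pos x (h (sub T w)) + displacement hh T w
  have hm : ∀ w ∈ Metric.ball v₀ δ, m w ∈ Prod.fst '' (h T).1.carrier := by
    intro w hw
    obtain ⟨l, hl, -⟩ := Ω'.exists_pos (hcell w hw)
    have h1 : (Ω'.pos x (h (sub T w)), l) ∈ (sub (h T) (displacement hh T w)).1.carrier := by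
      rw [← displacement_spec hh T w]
      exact hl
    exact ⟨_, h1, rfl⟩
  let f : Euc d → LabeledDelone d X' := fun w => (h T).1.sub (m w)
  have hf : ∀ w, f w = (h (sub T w)).1.sub (Ω'.pos x (h (sub T w))) := by
    intro w
    rw [displacement_spec hh T w]
    change _ = ((h T).1.sub _).sub _
    rw [LabeledDelone.sub_sub, ← displacement_spec hh T w, add_comm]
  have hfc : ContinuousOn f (Metric.ball v₀ δ) := by
    intro w hw
    apply ContinuousAt.continuousWithinAt
    have e : f = fun w => (h (sub T w)).1.sub (Ω'.pos x (h (sub T w))) := funext hf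
    rw [e]
    have h1 : ContinuousAt (fun w => h (sub T w)) w :=
      (hc.comp (Continuous.prodMk_right T)).continuousAt
    have h2 : ContinuousAt (fun w => Ω'.pos x (h (sub T w))) w :=
      ContinuousAt.comp (f := fun w => h (sub T w)) (Ω'.continuousAt_pos (hcell w hw)) h1
    exact LabeledDelone.continuous_sub.continuousAt.comp
      ((continuous_subtype_val.continuousAt.comp h1).prodMk h2)
  have hcount : (f '' Metric.ball v₀ δ).Countable := by
    refine (((h T).1.countable_carrier.image Prod.fst).image (h T).1.sub).mono ?_
    rintro _ ⟨w, hw, rfl⟩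
    exact ⟨m w, hm w hw, rfl⟩
  have hpre : IsPreconnected (f '' Metric.ball v₀ δ) :=
    (convex_ball v₀ δ).isPreconnected.image f hfc
  have htd : IsTotallyDisconnected (f '' Metric.ball v₀ δ) := by
    rw [← totallyDisconnectedSpace_subtype_iff]
    have : T35Space (LabeledDelone d X') := {}
    have := hcount.totallySeparatedSpace
    infer_instance
  have hsub := htd _ subset_rfl hpre
  have heq : f v = f v₀ := hsub ⟨v, hv, rfl⟩ ⟨v₀, Metric.mem_ball_self hδ, rfl⟩
  have hmm : m v = m v₀ := sub_injective (h T) (Subtype.ext heq)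
  have : Ω'.pos x (h (sub T v)) + displacement hh T v =
    Ω'.pos x (h (sub T v₀)) + displacement hh T v₀ := hmm
  rw [add_comm (displacement hh T v₀), ← this]
  abel

theorem continuous_displacement {Ω : TilingSpace d X} {Ω' : TilingSpace d X'} {h : C(Ω, Ω')}
    (hh : OrbitPreserving h) :
    Continuous fun P : Ω × Euc d => displacement hh P.1 P.2 := by
  have hc : Continuous fun P : Ω × Euc d => h (sub P.1 P.2) := h.continuous.comp continuous_sub
  have hpos : ∀ (x : Euc d) (T : Ω) (v : Euc d), h (sub T v) ∈ Ω'.cell x →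
      ContinuousAt (fun P : Ω × Euc d => Ω'.pos x (h (sub P.1 P.2))) (T, v) := fun x T v hx =>
    ContinuousAt.comp (f := fun P : Ω × Euc d => h (sub P.1 P.2)) (x := (T, v))
      (Ω'.continuousAt_pos hx) hc.continuousAt
  have hpos' : ∀ (x : Euc d) (T : Ω) (v : Euc d), h (sub T v) ∈ Ω'.cell x →
      ContinuousAt (fun T => Ω'.pos x (h (sub T v))) T := fun x T v hx =>
    ContinuousAt.comp (f := fun T : Ω => (T, v)) (x := T) (hpos x T v hx)
      (Continuous.prodMk_left v).continuousAt
  have hT : ∀ (T₀ : Ω) (v : Euc d), ContinuousAt (fun T => displacement hh T v) T₀ := by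
    intro T₀
    let S : Set (Euc d) := {v | ContinuousAt (fun T => displacement hh T v) T₀}
    have hloc : ∀ v₀ : Euc d, ∀ᶠ v in 𝓝 v₀, (v ∈ S ↔ v₀ ∈ S) := by
      intro v₀
      obtain ⟨x, δ, hδ, hx, hev⟩ := displacement_local hh T₀ v₀
      filter_upwards [Metric.ball_mem_nhds v₀ hδ] with v hv
      have hxv : h (sub T₀ v) ∈ Ω'.cell x := (hev.self_of_nhds v hv).1
      constructor
      · intro (hS : ContinuousAt (fun T => displacement hh T v) T₀)
        change ContinuousAt (fun T => displacement hh T v₀) T₀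
        have : ContinuousAt (fun T => displacement hh T v - Ω'.pos x (h (sub T v₀)) +
          Ω'.pos x (h (sub T v))) T₀ := (hS.sub (hpos' _ _ _ hx)).add (hpos' _ _ _ hxv)
        refine this.congr (hev.mono fun T hT => ?_)
        simp only [(hT v hv).2]
        abel
      · intro (hS : ContinuousAt (fun T => displacement hh T v₀) T₀)
        change ContinuousAt (fun T => displacement hh T v) T₀
        have : ContinuousAt (fun T => displacement hh T v₀ + Ω'.pos x (h (sub T v₀)) -
          Ω'.pos x (h (sub T v))) T₀ := (hS.add (hpos' _ _ _ hx)).sub (hpos' _ _ _ hxv)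
        exact this.congr (hev.mono fun T hT => ((hT v hv).2).symm)
    have hclopen : IsClopen S := by
      constructor
      · rw [← isOpen_compl_iff, isOpen_iff_mem_nhds]
        intro v hv
        filter_upwards [hloc v] with w hw
        exact fun h => hv (hw.1 h)
      · rw [isOpen_iff_mem_nhds]
        intro v hv
        filter_upwards [hloc v] with w hw
        exact hw.2 hv
    have h0 : (0 : Euc d) ∈ S := by
      change ContinuousAt (fun T => displacement hh T 0) T₀
      simp only [displacement_zero]
      exact continuousAt_const
    have : S = Set.univ := hclopen.eq_univ ⟨0, h0⟩
    intro v
    exact (this ▸ Set.mem_univ v : v ∈ S)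
  rw [continuous_iff_continuousAt]
  rintro ⟨T₀, v₀⟩
  obtain ⟨x, δ, hδ, hx, hev⟩ := displacement_local hh T₀ v₀
  have h1 : ContinuousAt (fun P : Ω × Euc d => displacement hh P.1 v₀ +
      Ω'.pos x (h (sub P.1 v₀)) - Ω'.pos x (h (sub P.1 P.2))) (T₀, v₀) :=
    ((ContinuousAt.comp (f := Prod.fst) (x := (T₀, v₀)) (hT T₀ v₀) continuous_fst.continuousAt).add
      (ContinuousAt.comp (f := Prod.fst) (x := (T₀, v₀)) (hpos' x T₀ v₀ hx)
        continuous_fst.continuousAt)).sub (hpos x T₀ v₀ hx)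
  refine h1.congr ?_
  rw [nhds_prod_eq]
  filter_upwards [hev.prod_mk (Metric.ball_mem_nhds v₀ hδ)] with P hP
  exact ((hP.1 P.2 hP.2).2).symm

/-- The weak class `[h]_w ∈ H¹_w(Ω; ℝ^d)` of an orbit-preserving continuous map `h`: the class of
the cocycle `(T, v) ↦ h_T(v)`. -/
noncomputable def weakClass {Ω : TilingSpace d X} {Ω' : TilingSpace d X'} (h : C(Ω, Ω'))
    (hh : OrbitPreserving h) : Ω.WeakH1 :=
  QuotientAddGroup.mk
    ⟨⟨fun P => displacement hh P.1 P.2, continuous_displacement hh⟩, displacement_add hh⟩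

end TilingSpace

universe u v w t

/-! ### First Čech cohomology with constant coefficients, and the strong class of a map -/

/-- A Čech `1`-cocycle on `Y` with values in the (discrete) group `A`: an open cover `(U i)` and
locally constant functions `g i j` on `U i ∩ U j` (the values elsewhere play no role) with
`g i j + g j k = g i k` on triple intersections. -/
structure CechCocycle (Y : Type u) [TopologicalSpace Y] (A : Type v) [AddCommGroup A] where
  ι : Type w
  U : ι → Set Y
  isOpen : ∀ i, IsOpen (U i)
  cover : ∀ y, ∃ i, y ∈ U i
  g : ι → ι → Y → A
  locConst : ∀ i j, ∀ y, y ∈ U i → y ∈ U j → ∀ᶠ z in 𝓝 y, g i j z = g i j y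
  cocycle : ∀ i j k, ∀ y, y ∈ U i → y ∈ U j → y ∈ U k → g i j y + g j k y = g i k y

namespace CechCocycle

variable {Y : Type u} [TopologicalSpace Y] {A : Type v} [AddCommGroup A]

/-- Two Čech cocycles have the same image in the direct limit over all open covers: on some common
refinement `(V k)` of their covers (with refinement maps `a`, `b`) they differ by the coboundary of
a family of locally constant functions `s k` on `V k`. It suffices to consider refinements indexed
by the points of `Y`, with `k ∈ V k`, since each refinement has a refinement of this form. -/
def Cohomologous (c c' : CechCocycle.{u, v, w} Y A) : Prop :=
  ∃ (V : Y → Set Y) (a : Y → c.ι) (b : Y → c'.ι) (s : Y → Y → A),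
    (∀ k, IsOpen (V k) ∧ k ∈ V k ∧ V k ⊆ c.U (a k) ∧ V k ⊆ c'.U (b k)) ∧
    (∀ k, ∀ y ∈ V k, ∀ᶠ z in 𝓝 y, s k z = s k y) ∧
    ∀ k l, ∀ y, y ∈ V k → y ∈ V l →
      c.g (a k) (a l) y - c'.g (b k) (b l) y = s l y - s k y

theorem Cohomologous.refl (c : CechCocycle.{u, v, w} Y A) : Cohomologous c c := by
  choose i hi using c.cover
  exact ⟨fun k => c.U (i k), i, i, fun _ _ => 0,
    fun k => ⟨c.isOpen _, hi k, subset_rfl, subset_rfl⟩, by simp, by simp⟩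

theorem Cohomologous.symm {c c' : CechCocycle.{u, v, w} Y A} (h : Cohomologous c c') :
    Cohomologous c' c := by
  obtain ⟨V, a, b, s, h1, h2, h3⟩ := h
  refine ⟨V, b, a, fun k y => -s k y, fun k => ⟨(h1 k).1, (h1 k).2.1, (h1 k).2.2.2, (h1 k).2.2.1⟩,
    fun k y hy => (h2 k y hy).mono fun z hz => congrArg Neg.neg hz, fun k l y hk hl => ?_⟩
  beta_reduce
  rw [← neg_sub, h3 k l y hk hl]
  abel

theorem Cohomologous.trans {c c' c'' : CechCocycle.{u, v, w} Y A} (h : Cohomologous c c')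
    (h' : Cohomologous c' c'') : Cohomologous c c'' := by
  obtain ⟨V, a, b, s, h1, h2, h3⟩ := h
  obtain ⟨V', a', b', s', h1', h2', h3'⟩ := h'
  refine ⟨fun k => V k ∩ V' k, a, b', fun k y => s k y + s' k y + c'.g (a' k) (b k) y,
    fun k => ⟨(h1 k).1.inter (h1' k).1, ⟨(h1 k).2.1, (h1' k).2.1⟩,
      Set.inter_subset_left.trans (h1 k).2.2.1, Set.inter_subset_right.trans (h1' k).2.2.2⟩,
    fun k y hy => ?_, fun k l y hk hl => ?_⟩
  · filter_upwards [h2 k y hy.1, h2' k y hy.2,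
      c'.locConst _ _ y ((h1' k).2.2.1 hy.2) ((h1 k).2.2.2 hy.1)] with z e1 e2 e3
    rw [e1, e2, e3]
  · have e1 := h3 k l y hk.1 hl.1
    have e2 := h3' k l y hk.2 hl.2
    have mbk := (h1 k).2.2.2 hk.1
    have mbl := (h1 l).2.2.2 hl.1
    have mak := (h1' k).2.2.1 hk.2
    have mal := (h1' l).2.2.1 hl.2
    have e3 := c'.cocycle _ _ _ y mak mbk mbl
    have e4 := c'.cocycle _ _ _ y mak mal mbl
    have e5 : c.g (a k) (a l) y = s l y - s k y + c'.g (b k) (b l) y := by rw [← e1]; abel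
    have e6 : c''.g (b' k) (b' l) y = c'.g (a' k) (a' l) y - (s' l y - s' k y) := by
      rw [← e2]; abel
    have e7 : c'.g (b k) (b l) y =
        c'.g (a' k) (a' l) y + c'.g (a' l) (b l) y - c'.g (a' k) (b k) y := by
      rw [e4, ← e3]; abel
    beta_reduce
    rw [e5, e6, e7]
    abel

/-- The relation of being cohomologous, as an equivalence relation. -/
def setoid (Y : Type u) [TopologicalSpace Y] (A : Type v) [AddCommGroup A] :
    Setoid (CechCocycle.{u, v, w} Y A) :=
  ⟨Cohomologous, Cohomologous.refl, Cohomologous.symm, Cohomologous.trans⟩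

/-- The pullback of a Čech cocycle along a continuous map. -/
def pullback {Z : Type t} [TopologicalSpace Z] (f : C(Y, Z)) (c : CechCocycle.{t, v, w} Z A) :
    CechCocycle.{u, v, w} Y A where
  ι := c.ι
  U i := f ⁻¹' c.U i
  isOpen i := (c.isOpen i).preimage f.continuous
  cover y := c.cover (f y)
  g i j y := c.g i j (f y)
  locConst i j y hi hj := f.continuous.continuousAt.eventually (c.locConst i j (f y) hi hj)
  cocycle i j k y hi hj hk := c.cocycle i j k (f y) hi hj hk

theorem Cohomologous.pullback {Z : Type t} [TopologicalSpace Z] (f : C(Y, Z))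
    {c c' : CechCocycle.{t, v, w} Z A} (h : Cohomologous c c') :
    Cohomologous (c.pullback f) (c'.pullback f) := by
  obtain ⟨V, a, b, s, h1, h2, h3⟩ := h
  exact ⟨fun k => f ⁻¹' V (f k), fun k => a (f k), fun k => b (f k), fun k y => s (f k) (f y),
    fun k => ⟨(h1 _).1.preimage f.continuous, (h1 _).2.1, Set.preimage_mono (h1 _).2.2.1,
      Set.preimage_mono (h1 _).2.2.2⟩,
    fun k y hy => f.continuous.continuousAt.eventually (h2 _ (f y) hy),
    fun k l y hk hl => h3 _ _ (f y) hk hl⟩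

end CechCocycle

/-- The first Čech cohomology of `Y` with coefficients in `A`. -/
def CechH1 (Y : Type u) [TopologicalSpace Y] (A : Type v) [AddCommGroup A] : Type (max u v (w + 1)) :=
  Quotient (CechCocycle.setoid.{u, v, w} Y A)

/-- The map `f^*` induced by a continuous map `f` on Čech cohomology. -/
def CechH1.map {Y : Type u} {Z : Type t} [TopologicalSpace Y] [TopologicalSpace Z] {A : Type v}
    [AddCommGroup A] (f : C(Y, Z)) : CechH1.{t, v, w} Z A → CechH1.{u, v, w} Y A :=
  Quotient.map (CechCocycle.pullback f) fun _ _ h => h.pullback f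

namespace TilingSpace

variable {d : ℕ} {X : Type u} {X' : Type t} [MetricSpace X] [MetricSpace X']

/-- The fundamental shape class, as a Čech cocycle on an FLC tiling space. On `cell x`, the cocycle
`(T, v) ↦ v` has the transversally locally constant primitive `T ↦ -pos x T` (that is, minus the
position of a point of `T`; it changes by `v` when `T` is replaced by `T - v`, `v` small), and
`g x y` is the difference of the primitives on `cell y` and `cell x`: the displacement from the
point of `T` near `y` to the point of `T` near `x`. -/
noncomputable def shapeCocycle (Ω : TilingSpace d X) (hΩ : Ω.FLC) : CechCocycle.{u, 0, 0} Ω (Euc d) where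
  ι := Euc d
  U x := Ω.cell x
  isOpen x := Ω.isOpen_cell x
  cover T := Ω.exists_cell T
  g x y T := Ω.pos x T - Ω.pos y T
  locConst _ _ _ hx hy := hΩ.eventually_eq hx hy
  cocycle _ _ _ _ _ _ _ := sub_add_sub_cancel _ _ _

/-- The fundamental shape class `[F(Ω)]` of an FLC tiling space in Čech cohomology. -/
noncomputable def shapeClass (Ω : TilingSpace d X) (hΩ : Ω.FLC) : CechH1.{u, 0, 0} Ω (Euc d) :=
  Quotient.mk (CechCocycle.setoid.{u, 0, 0} Ω (Euc d)) (Ω.shapeCocycle hΩ)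

/-- The strong class `[h]_s = h^*[F(Ω')]` of a continuous map `h` between FLC tiling spaces. -/
noncomputable def strongClass {Ω : TilingSpace d X} {Ω' : TilingSpace d X'} (h : C(Ω, Ω'))
    (hΩ' : Ω'.FLC) : CechH1.{u, 0, 0} Ω (Euc d) :=
  CechH1.map h (Ω'.shapeClass hΩ')

end TilingSpace

/-!
Write `h_T(v)` for the displacement cocycle of an orbit-preserving map `h`. If
`h₁_T(v) - h₂_T(v) = s(T - v) - s(T)` with `s` continuous, then `g(T) = h₂(T) - s(T)` satisfies
`g(T - v) = g(T) - h₁_T(v)`. Hence `g` is carried by the orbit equivalence `h₁` to a factor map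
`φ = g ∘ h₁⁻¹`, and `T ↦ h₂(T) - t s(T)` is a homotopy from `h₂` to `φ ∘ h₁ = g`. An equality of
weak classes says precisely that such an `s` exists.

An equality of strong classes provides an `s` that is, up to locally constant functions, the
position of a point of `h₂(T)` minus the position of a point of `h₁(T)`. Therefore
`φ(h₁(T)) = h₂(T) - s(T)` is locally the pattern of `h₂(T)` seen from one of its points, which is
locally constant by FLC, translated by the position of a point of `h₁(T)`. So `φ` is local near
each element, and a uniform radius of locality comes from compactness of `Ω₁`.
-/

open Filter Set
open scoped Uniformity

section Ultralimit

variable {α Y : Type*} [TopologicalSpace Y] {U : Ultrafilter α} {S : α → Set Y}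

/-- The limit of the sets `S a` along an ultrafilter: the points all of whose neighbourhoods meet
`S a` for almost all `a`. (For an ultrafilter the lower and the upper Kuratowski limits coincide.)
It is used to construct limits of labelled Delone sets. -/
def ultralimit (U : Ultrafilter α) (S : α → Set Y) : Set Y :=
  {p | ∀ N ∈ 𝓝 p, ∀ᶠ a in U, (S a ∩ N).Nonempty}

theorem nonempty_inter_ultralimit {C : Set Y} (hC : IsCompact C)
    (h : ∀ᶠ a in U, (S a ∩ C).Nonempty) : (C ∩ ultralimit U S).Nonempty := by
  obtain ⟨f, hf⟩ := h.choice
  obtain ⟨p, hpC, hp⟩ := hC.ultrafilter_le_nhds' (U.map f) (hf.mono fun _ ha => ha.2)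
  refine ⟨p, hpC, fun N hN => ?_⟩
  filter_upwards [hf, hp hN] with a ha haN using ⟨f a, ha.1, haN⟩

theorem eventually_inter_subset_of_ultralimit_subset {C V : Set Y} (hC : IsCompact C)
    (hV : IsOpen V) (h : ultralimit U S ⊆ V) : ∀ᶠ a in U, S a ∩ C ⊆ V := by
  by_contra hfar
  rw [← Ultrafilter.eventually_not] at hfar
  obtain ⟨p, hp, hpU⟩ := nonempty_inter_ultralimit (hC.diff hV) <| hfar.mono fun a ha => by
    obtain ⟨q, hq, hqV⟩ := not_subset.1 ha
    exact (⟨q, hq.1, hq.2, hqV⟩ : (S a ∩ (C \ V)).Nonempty)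
  exact hp.2 (h hpU)

theorem ultralimit_subset_of_isClosed {C : Set Y} (hC : IsClosed C) (h : ∀ᶠ a in U, S a ⊆ C) :
    ultralimit U S ⊆ C := by
  intro p hp
  by_contra hpC
  obtain ⟨a, ⟨q, hq, hqC⟩, ha⟩ := ((hp _ (hC.isOpen_compl.mem_nhds hpC)).and h).exists
  exact hqC (ha hq)

theorem pairwise_ultralimit [T2Space Y] {ρ : Y → Y → Prop} (hρ : IsClosed {P : Y × Y | ρ P.1 P.2})
    (h : ∀ᶠ a in U, (S a).Pairwise ρ) : (ultralimit U S).Pairwise ρ := by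
  intro p hp q hq hne
  by_contra hpq
  have hopen : IsOpen {P : Y × Y | P.1 ≠ P.2 ∧ ¬ρ P.1 P.2} :=
    (isOpen_ne_fun continuous_fst continuous_snd).inter hρ.isOpen_compl
  obtain ⟨N, hN, N', hN', hsub⟩ := mem_nhds_prod_iff.1 (hopen.mem_nhds (x := (p, q)) ⟨hne, hpq⟩)
  obtain ⟨a, ⟨p', hp', hpN⟩, ⟨q', hq', hqN⟩, ha⟩ := ((hp N hN).and ((hq N' hN').and h)).exists
  have hbad := hsub (mk_mem_prod hpN hqN)
  exact hbad.2 (ha hp' hq' hbad.1)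

end Ultralimit

namespace LabeledDelone

variable {d : ℕ} {X : Type*} {Λ Λ' : LabeledDelone d X}

section Patch

theorem mem_patch_zero {r : ℝ} {p : Euc d × X} :
    p ∈ Λ.patch 0 r ↔ p ∈ Λ.carrier ∧ ‖p.1‖ < r := by
  simp [patch]

theorem mem_patch_sub {x y : Euc d} {r : ℝ} {p : Euc d × X} :
    p ∈ (Λ.sub x).patch y r ↔ (p.1 + x, p.2) ∈ Λ.patch (y + x) r := by
  simp [patch, mem_sub]

theorem patch_eq_inter_of_add_dist_le {x y : Euc d} {r R : ℝ} (h : r + dist x y ≤ R) :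
    Λ.patch x r = Λ.patch y R ∩ {p | dist p.1 x < r} := by
  ext p
  refine ⟨fun hp => ⟨⟨hp.1, ?_⟩, hp.2⟩, fun hp => ⟨hp.1.1, hp.2⟩⟩
  linarith [hp.2, dist_triangle p.1 x y]

theorem patch_sub_eq_patch_sub {w : Euc d} {r R : ℝ} (hr : r + ‖w‖ ≤ R)
    (h : Λ.patch 0 R = Λ'.patch 0 R) : (Λ.sub w).patch 0 r = (Λ'.sub w).patch 0 r := by
  have hw : r + dist (0 + w) 0 ≤ R := by simpa using hr
  ext p
  rw [mem_patch_sub, mem_patch_sub, patch_eq_inter_of_add_dist_le hw, h,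
    ← patch_eq_inter_of_add_dist_le hw]

end Patch

/-- The labelled Delone sets with separation at least `r`, covering radius at most `R` and labels in
`K`. For compact `K` and `r > 0` they form a compact set, in which hulls are located. -/
def uniformlyDelone (d : ℕ) (r R : ℝ) (K : Set X) : Set (LabeledDelone d X) :=
  {Λ | (Λ.carrier.Pairwise fun p q => r ≤ dist p.1 q.1) ∧
    (∀ x : Euc d, ∃ p ∈ Λ.carrier, dist p.1 x ≤ R) ∧ ∀ p ∈ Λ.carrier, p.2 ∈ K}

theorem sub_mem_uniformlyDelone {r R : ℝ} {K : Set X} (hΛ : Λ ∈ uniformlyDelone d r R K)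
    (x : Euc d) : Λ.sub x ∈ uniformlyDelone d r R K := by
  obtain ⟨hsep, hcov, hlab⟩ := hΛ
  refine ⟨fun p hp q hq hne => ?_, fun y => ?_, fun p hp => hlab (p.1 + x, p.2) hp⟩
  · simpa only [dist_add_right] using hsep hp hq fun e => hne (by
      simpa only [Prod.ext_iff, add_left_inj] using e)
  · obtain ⟨p, hp, hpy⟩ := hcov (y + x)
    refine ⟨(p.1 - x, p.2), by simpa only [mem_sub, sub_add_cancel] using hp, ?_⟩
    rwa [← dist_add_right _ _ x, sub_add_cancel]

variable [MetricSpace X]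

section Near

/-- Below half the separation, being close is automatically a one-to-one relation. -/
theorem near_of_pairwise_le_dist {r ε : ℝ}
    (hΛ : Λ.carrier.Pairwise fun p q => r ≤ dist p.1 q.1)
    (hΛ' : Λ'.carrier.Pairwise fun p q => r ≤ dist p.1 q.1)
    (h : ∀ p ∈ Λ.carrier, ‖p.1‖ < ε⁻¹ → ∃ q ∈ Λ'.carrier, dist p q < min ε (r / 2))
    (h' : ∀ q ∈ Λ'.carrier, ‖q.1‖ < ε⁻¹ → ∃ p ∈ Λ.carrier, dist p q < min ε (r / 2)) :
    Near ε Λ Λ' := by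
  have hfst : ∀ {p q : Euc d × X}, dist p q < min ε (r / 2) → dist p.1 q.1 < r / 2 := fun hd =>
    (le_max_left _ _).trans_lt (hd.trans_le (min_le_right _ _))
  refine ⟨fun p q => p ∈ Λ.carrier ∧ q ∈ Λ'.carrier ∧ dist p q < min ε (r / 2),
    fun p q ⟨hp, hq, hd⟩ => ⟨hp, hq, hd.trans_le (min_le_left _ _)⟩, ⟨?_, ?_⟩,
    fun p hp hn => (h p hp hn).imp fun q hq => ⟨hp, hq⟩,
    fun q hq hn => (h' q hq hn).imp fun p hp => ⟨hp.1, hq, hp.2⟩⟩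
  · rintro p p' q ⟨hp, -, hd⟩ ⟨hp', -, hd'⟩
    refine hΛ.eq hp hp' (not_le.2 ?_)
    linarith [hfst hd, hfst hd', dist_triangle_right p.1 p'.1 q.1]
  · rintro p q q' ⟨-, hq, hd⟩ ⟨-, hq', hd'⟩
    refine hΛ'.eq hq hq' (not_le.2 ?_)
    linarith [hfst hd, hfst hd', dist_triangle_left q.1 q'.1 p.1]

theorem near_of_patch_eq {ε R : ℝ} (hε : 0 < ε) (hR : ε⁻¹ ≤ R)
    (h : Λ.patch 0 R = Λ'.patch 0 R) : Near ε Λ Λ' := by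
  obtain ⟨r, hr, hsep⟩ := Λ.separated
  obtain ⟨r', hr', hsep'⟩ := Λ'.separated
  refine near_of_pairwise_le_dist (r := min r r')
    (fun p hp q hq hne => (min_le_left _ _).trans (hsep p hp q hq hne))
    (fun p hp q hq hne => (min_le_right _ _).trans (hsep' p hp q hq hne))
    (fun p hp hn => ⟨p, (h.subset (mem_patch_zero.2 ⟨hp, hn.trans_le hR⟩)).1, ?_⟩)
    (fun q hq hn => ⟨q, (h.superset (mem_patch_zero.2 ⟨hq, hn.trans_le hR⟩)).1, ?_⟩)
  all_goals
    rw [dist_self]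
    exact lt_min hε (half_pos (lt_min hr hr'))

theorem hasBasis_uniformity : (𝓤 (LabeledDelone d X)).HasBasis (fun ε : ℝ => 0 < ε)
    (fun ε => {P | Near ε P.1 P.2}) :=
  (nearBasis d X).hasBasis.to_hasBasis
    (by rintro _ ⟨ε, hε, rfl⟩; exact ⟨ε, hε, Subset.rfl⟩)
    fun ε hε => ⟨_, ⟨ε, hε, rfl⟩, Subset.rfl⟩

theorem Near.patch_subset {ε r : ℝ} {D : Set (Euc d × X)} (hr : r ≤ ε⁻¹)
    (hD : D.Pairwise fun p q => ε ≤ dist p q) (hΛ : Λ.patch 0 (r + ε) ⊆ D)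
    (hΛ' : Λ'.patch 0 (r + ε) ⊆ D) (h : Near ε Λ Λ') : Λ.patch 0 r ⊆ Λ'.patch 0 r := by
  obtain ⟨M, hM, -, hdom, -⟩ := h
  intro p hp
  rw [mem_patch_zero] at hp
  obtain ⟨q, hpq⟩ := hdom p hp.1 (hp.2.trans_le hr)
  obtain ⟨-, hq, hd⟩ := hM p q hpq
  have hdist : dist p.1 q.1 < ε := (le_max_left _ _).trans_lt hd
  have hqn : ‖q.1‖ < r + ε := by
    rw [dist_comm, dist_eq_norm] at hdist
    linarith [norm_sub_norm_le q.1 p.1]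
  have hpn : ‖p.1‖ < r + ε := by linarith [dist_nonneg (x := p.1) (y := q.1)]
  obtain rfl : p = q := hD.eq (hΛ (mem_patch_zero.2 ⟨hp.1, hpn⟩))
    (hΛ' (mem_patch_zero.2 ⟨hq, hqn⟩)) (not_le.2 hd)
  exact mem_patch_zero.2 ⟨hq, hp.2⟩

theorem eventually_patch_eq_of_finite {D : Set (Euc d × X)} (hD : D.Finite) {r : ℝ}
    (hΛ : Λ.patch 0 (r + 1) ⊆ D) :
    ∀ᶠ Λ' in 𝓝 Λ, Λ'.patch 0 (r + 1) ⊆ D → Λ'.patch 0 r = Λ.patch 0 r := by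
  have hsep : ∀ᶠ ε : ℝ in 𝓝[>] 0, ∀ P ∈ D.offDiag, ε ≤ dist P.1 P.2 :=
    (eventually_all_finite hD.offDiag).2 fun P hP =>
      nhdsWithin_le_nhds (eventually_le_nhds (dist_pos.2 hP.2.2))
  obtain ⟨ε, hεD, hεr, hε0, hε1⟩ := (hsep.and ((tendsto_inv_nhdsGT_zero.eventually_ge_atTop r).and
    (Ioo_mem_nhdsGT one_pos))).exists
  have hpair : D.Pairwise fun p q => ε ≤ dist p q := fun p hp q hq hne => hεD (p, q) ⟨hp, hq, hne⟩
  have hshrink : ∀ Λ : LabeledDelone d X, Λ.patch 0 (r + ε) ⊆ Λ.patch 0 (r + 1) := fun _ _ hp =>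
    ⟨hp.1, hp.2.trans (by linarith)⟩
  filter_upwards [(hasBasis_nhds Λ).mem_of_mem hε0] with Λ' hnear hΛ'
  have hΛε := (hshrink Λ).trans hΛ
  have hΛε' := (hshrink Λ').trans hΛ'
  exact (hnear.symm.patch_subset hεr hpair hΛε' hΛε).antisymm
    (hnear.patch_subset hεr hpair hΛε hΛε')

end Near

section Compactness

variable {r R : ℝ} {K : Set X}

theorem exists_carrier_eq_ultralimit (hr : 0 < r) (hK : IsCompact K)
    {U : Ultrafilter (LabeledDelone d X)} (hU : uniformlyDelone d r R K ∈ U) :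
    ∃ Λ ∈ uniformlyDelone d r R K, Λ.carrier = ultralimit U carrier := by
  have hdist : Continuous fun P : (Euc d × X) × (Euc d × X) => dist P.1.1 P.2.1 := by fun_prop
  have hsep : (ultralimit U carrier).Pairwise fun p q : Euc d × X => r ≤ dist p.1 q.1 :=
    pairwise_ultralimit (isClosed_le continuous_const hdist) (mem_of_superset hU fun _ hΛ => hΛ.1)
  have hlab : ultralimit U carrier ⊆ Prod.snd ⁻¹' K :=
    ultralimit_subset_of_isClosed (hK.isClosed.preimage continuous_snd)
      (mem_of_superset hU fun _ hΛ => hΛ.2.2)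
  have hcov : ∀ x : Euc d, ∃ p ∈ ultralimit U carrier, dist p.1 x ≤ R := by
    intro x
    obtain ⟨p, ⟨hpx, -⟩, hp⟩ := nonempty_inter_ultralimit ((isCompact_closedBall x R).prod hK) <|
      mem_of_superset hU fun Λ hΛ =>
        let ⟨q, hq, hqx⟩ := hΛ.2.1 x
        (⟨q, hq, hqx, hΛ.2.2 q hq⟩ : (Λ.carrier ∩ Metric.closedBall x R ×ˢ K).Nonempty)
    exact ⟨p, hp, hpx⟩
  have hR : 0 ≤ R := let ⟨_, _, hp⟩ := hcov 0; dist_nonneg.trans hp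
  exact ⟨⟨ultralimit U carrier, ⟨r, hr, fun p hp q hq hne => hsep hp hq hne⟩,
    ⟨R + 1, by positivity, fun x => let ⟨p, hp, hpx⟩ := hcov x; ⟨p, hp, by linarith⟩⟩⟩,
    ⟨hsep, hcov, hlab⟩, rfl⟩

theorem le_nhds_of_carrier_eq_ultralimit (hr : 0 < r) (hK : IsCompact K)
    {U : Ultrafilter (LabeledDelone d X)} (hU : uniformlyDelone d r R K ∈ U)
    (hΛ : Λ ∈ uniformlyDelone d r R K) (h : Λ.carrier = ultralimit U carrier) : ↑U ≤ 𝓝 Λ := by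
  rw [(hasBasis_nhds Λ).ge_iff]
  intro ε hε
  have hη : 0 < min ε (r / 2) := by positivity
  have hlimit : ∀ᶠ Λ' : LabeledDelone d X in U, ∀ p ∈ Λ.patch 0 ε⁻¹,
      ∃ q ∈ Λ'.carrier, dist p q < min ε (r / 2) := by
    refine (eventually_all_finite (Λ.patch_finite 0 ε⁻¹)).2 fun p hp => ?_
    filter_upwards [(h.subset hp.1) _ (Metric.ball_mem_nhds p hη)] with Λ' ⟨q, hq, hqp⟩
    exact ⟨q, hq, Metric.mem_ball'.1 hqp⟩
  have happrox : ∀ᶠ Λ' : LabeledDelone d X in U,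
      Λ'.carrier ∩ Metric.closedBall 0 ε⁻¹ ×ˢ K ⊆ Metric.thickening (min ε (r / 2)) Λ.carrier :=
    eventually_inter_subset_of_ultralimit_subset ((isCompact_closedBall _ _).prod hK)
      Metric.isOpen_thickening (h.superset.trans (Metric.self_subset_thickening hη _))
  filter_upwards [hlimit, happrox, hU] with Λ' hto hfrom hΛ'
  refine near_of_pairwise_le_dist hΛ.1 hΛ'.1
    (fun p hp hn => hto p (mem_patch_zero.2 ⟨hp, hn⟩)) fun q hq hn => ?_
  obtain ⟨p, hp, hqp⟩ := Metric.mem_thickening_iff.1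
    (hfrom ⟨hq, mem_closedBall_zero_iff.2 hn.le, hΛ'.2.2 q hq⟩)
  exact ⟨p, hp, by rwa [dist_comm]⟩

theorem isCompact_uniformlyDelone (hr : 0 < r) (hK : IsCompact K) :
    IsCompact (uniformlyDelone d r R K) :=
  isCompact_iff_ultrafilter_le_nhds'.2 fun _ hU =>
    let ⟨Λ, hΛ, hlim⟩ := exists_carrier_eq_ultralimit hr hK hU
    ⟨Λ, hΛ, le_nhds_of_carrier_eq_ultralimit hr hK hU hΛ hlim⟩

theorem isCompact_hull (hK : IsCompact K) (hΛ : ∀ p ∈ Λ.carrier, p.2 ∈ K) :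
    IsCompact Λ.hull := by
  obtain ⟨r, hr, hsep⟩ := Λ.separated
  obtain ⟨R, -, hcov⟩ := Λ.relDense
  have hmem : Λ ∈ uniformlyDelone d r R K :=
    ⟨fun p hp q hq hne => hsep p hp q hq hne,
      fun x => let ⟨p, hp, hpx⟩ := hcov x; ⟨p, hp, hpx.le⟩, hΛ⟩
  have hsub : Λ.orbit ⊆ uniformlyDelone d r R K := by
    rintro _ ⟨x, rfl⟩
    exact sub_mem_uniformlyDelone hmem x
  exact (isCompact_uniformlyDelone hr hK).closure_of_subset hsub

end Compactness

end LabeledDelone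

namespace CechCocycle

theorem Cohomologous.exists_eventually_eq {Y A : Type*} [TopologicalSpace Y] [AddCommGroup A]
    {c c' : CechCocycle Y A} (h : Cohomologous c c') {p : c.ι → Y → A} {q : c'.ι → Y → A}
    (hp : ∀ i j, ∀ y ∈ c.U i, y ∈ c.U j → c.g i j y = p i y - p j y)
    (hq : ∀ i j, ∀ y ∈ c'.U i, y ∈ c'.U j → c'.g i j y = q i y - q j y) :
    ∃ s : Y → A, ∀ y₀, ∃ i j a, y₀ ∈ c.U i ∧ y₀ ∈ c'.U j ∧
      ∀ᶠ y in 𝓝 y₀, s y = q j y - p i y + a := by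
  obtain ⟨V, i, j, t, hV, ht, hcob⟩ := h
  have hi : ∀ k, V k ⊆ c.U (i k) := fun k => (hV k).2.2.1
  have hj : ∀ k, V k ⊆ c'.U (j k) := fun k => (hV k).2.2.2
  have hself : ∀ y, y ∈ V y := fun y => (hV y).2.1
  have hglue : ∀ k, ∀ y ∈ V k, q (j y) y - p (i y) y - t y y = q (j k) y - p (i k) y - t k y := by
    intro k y hy
    have hky := hcob k y y hy (hself y)
    rw [hp _ _ y (hi k hy) (hi y (hself y)), hq _ _ y (hj k hy) (hj y (hself y))] at hky
    rw [← sub_eq_zero, ← sub_eq_zero.2 hky]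
    abel
  refine ⟨fun y => q (j y) y - p (i y) y - t y y, fun k =>
    ⟨i k, j k, -t k k, hi k (hself k), hj k (hself k), ?_⟩⟩
  filter_upwards [(hV k).1.mem_nhds (hself k), ht k k (hself k)] with y hy hty
  rw [hglue k y hy, hty, sub_eq_add_neg _ (t k k)]

end CechCocycle

namespace TilingSpace

section FiniteLocalComplexity

variable {d : ℕ} {X : Type*} [MetricSpace X] {Ω : TilingSpace d X}

theorem FLC.exists_finite_patch_sub_subset (hΩ : Ω.FLC) (R : ℝ) :
    ∃ D : Set (Euc d × X), D.Finite ∧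
      ∀ (T : Ω), ∀ p ∈ T.1.carrier, (T.1.sub p.1).patch 0 R ⊆ D := by
  obtain ⟨F, hF, hP⟩ := hΩ R
  refine ⟨⋃ P ∈ {P ∈ F | P.Finite}, (fun a : (Euc d × X) × (Euc d × X) =>
    (a.1.1 - a.2.1, a.1.2)) '' (P ×ˢ P), (hF.subset (sep_subset _ _)).biUnion
      fun P hP => (hP.2.prod hP.2).image _, fun T p hp q hq => ?_⟩
  have hR : 0 < R := (norm_nonneg q.1).trans_lt (LabeledDelone.mem_patch_zero.1 hq).2
  rw [LabeledDelone.mem_patch_sub, zero_add] at hq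
  obtain ⟨z, hz⟩ := hP T p.1
  have hpp : p ∈ T.1.patch p.1 R := ⟨hp, by rwa [dist_self]⟩
  exact mem_biUnion (⟨hz, (T.1.patch_finite _ _).image _⟩ : _ ∈ {P ∈ F | P.Finite})
    ⟨((q.1 + p.1 - z, q.2), (p.1 - z, p.2)), ⟨⟨_, hq, rfl⟩, ⟨p, hpp, rfl⟩⟩, by simp⟩

theorem FLC.eventually_patch_sub_pos_eq (hΩ : Ω.FLC) {x : Euc d} {T : Ω} (hx : T ∈ Ω.cell x)
    (r : ℝ) :
    ∀ᶠ T' in 𝓝 T, (T'.1.sub (Ω.pos x T')).patch 0 r = (T.1.sub (Ω.pos x T)).patch 0 r := by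
  obtain ⟨D, hD, hsub⟩ := hΩ.exists_finite_patch_sub_subset (r + 1)
  have hmem : ∀ T' ∈ Ω.cell x, (T'.1.sub (Ω.pos x T')).patch 0 (r + 1) ⊆ D := fun T' hT' =>
    let ⟨_, hl, _⟩ := Ω.exists_pos hT'
    hsub T' _ hl
  have hcont : ContinuousAt (fun T' : Ω => T'.1.sub (Ω.pos x T')) T :=
    LabeledDelone.continuous_sub.continuousAt.comp
      (continuous_subtype_val.continuousAt.prodMk (Ω.continuousAt_pos hx))
  filter_upwards [hcont.eventually (LabeledDelone.eventually_patch_eq_of_finite hD (hmem T hx)),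
    (Ω.isOpen_cell x).mem_nhds hx] with T' hT' hcell
  exact hT' (hmem T' hcell)

theorem FLC.exists_finite_labels (hΩ : Ω.FLC) :
    ∃ L : Set X, L.Finite ∧ ∀ T : Ω, ∀ p ∈ T.1.carrier, p.2 ∈ L := by
  obtain ⟨D, hD, hsub⟩ := hΩ.exists_finite_patch_sub_subset 1
  refine ⟨Prod.snd '' D, hD.image _, fun T p hp => ⟨(0, p.2), hsub T p hp ?_, rfl⟩⟩
  exact LabeledDelone.mem_patch_zero.2 ⟨by simpa [LabeledDelone.mem_sub] using hp, by simp⟩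

theorem FLC.compactSpace (hΩ : Ω.FLC) : CompactSpace Ω := by
  obtain ⟨L, hL, hlab⟩ := hΩ.exists_finite_labels
  obtain ⟨Λ, hΛ⟩ := Ω.nonempty
  rw [← isCompact_iff_compactSpace, ← Ω.hull_eq Λ hΛ]
  exact LabeledDelone.isCompact_hull hL.isCompact (hlab ⟨Λ, hΛ⟩)

end FiniteLocalComplexity

section Locality

variable {d : ℕ} {X X' : Type*} [MetricSpace X] [MetricSpace X'] {Ω : TilingSpace d X}
  {Ω' : TilingSpace d X'}

theorem eventually_mem_of_patch_eq {V : Set (Ω × Ω)} (hV : V ∈ 𝓤 Ω) :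
    ∀ᶠ R : ℝ in atTop, ∀ T T' : Ω, T.1.patch 0 R = T'.1.patch 0 R → (T, T') ∈ V := by
  rw [uniformity_subtype, mem_comap] at hV
  obtain ⟨W, hW, hWV⟩ := hV
  obtain ⟨ε, hε, hεW⟩ := LabeledDelone.hasBasis_uniformity.mem_iff.1 hW
  filter_upwards [eventually_ge_atTop ε⁻¹] with R hR T T' h
  exact hWV (hεW (LabeledDelone.near_of_patch_eq hε hR h))

theorem isLocalMap_of_eventually [CompactSpace Ω] {φ : C(Ω, Ω')}
    (h : ∀ (r : ℝ) (T₀ : Ω), ∀ᶠ Q : ℝ × (Ω × Ω) in atTop ×ˢ 𝓝 (T₀, T₀),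
      Q.2.1.1.patch 0 Q.1 = Q.2.2.1.patch 0 Q.1 →
        (φ Q.2.1).1.patch 0 r = (φ Q.2.2).1.patch 0 r) :
    IsLocalMap φ := by
  intro r _
  have hdiag : IsCompact (diagonal Ω) := isClosed_diagonal.isCompact
  have hunif : ∀ᶠ Q : ℝ × (Ω × Ω) in atTop ×ˢ 𝓤 Ω, Q.2.1.1.patch 0 Q.1 = Q.2.2.1.patch 0 Q.1 →
      (φ Q.2.1).1.patch 0 r = (φ Q.2.2).1.patch 0 r := by
    rw [← nhdsSet_diagonal_eq_uniformity, hdiag.prod_nhdsSet_eq_biSup]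
    simp only [eventually_iSup]
    rintro ⟨T, T'⟩ hTT'
    obtain rfl : T = T' := hTT'
    exact h r T
  obtain ⟨large, hlarge, close, hclose, himp⟩ := eventually_prod_iff.1 hunif
  obtain ⟨R, hR, hR0, hRclose⟩ := (hlarge.and ((eventually_gt_atTop 0).and
    (eventually_mem_of_patch_eq hclose))).exists
  exact ⟨R, hR0, fun T T' hTT' => himp hR (hRclose T T' hTT') hTT'⟩

theorem pos_eq_pos_of_patch_eq {x : Euc d} {T T' : Ω} (hx : T ∈ Ω.cell x) {R : ℝ}
    (hR : ‖x‖ + Ω.radius ≤ R) (h : T.1.patch 0 R = T'.1.patch 0 R) : Ω.pos x T = Ω.pos x T' := by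
  obtain ⟨p, hp, hpx⟩ := hx
  have hpR : ‖p.1‖ < R := by
    linarith [norm_sub_norm_le p.1 x, dist_eq_norm p.1 x]
  have hp' : p ∈ T'.1.patch 0 R := h.subset (LabeledDelone.mem_patch_zero.2 ⟨hp, hpR⟩)
  rw [Ω.pos_eq hp hpx, Ω.pos_eq hp'.1 hpx]

theorem isLocalMap_of_eventually_patch_eq_comp_pos [CompactSpace Ω] {φ : C(Ω, Ω')}
    (h : ∀ (r : ℝ) (T₀ : Ω), ∃ (x : Euc d) (P : Euc d → Set (Euc d × X')), T₀ ∈ Ω.cell x ∧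
      ∀ᶠ T in 𝓝 T₀, (φ T).1.patch 0 r = P (Ω.pos x T)) :
    IsLocalMap φ := by
  refine isLocalMap_of_eventually fun r T₀ => ?_
  obtain ⟨x, P, hx, hP⟩ := h r T₀
  have hnear := hP.and ((Ω.isOpen_cell x).mem_nhds hx)
  rw [nhds_prod_eq]
  filter_upwards [(eventually_ge_atTop (‖x‖ + Ω.radius)).prod_mk (hnear.prod_mk hnear)]
  rintro ⟨R, T, T'⟩ ⟨hR, ⟨hT, hcell⟩, hT', -⟩ hTT'
  change (φ T).1.patch 0 r = (φ T').1.patch 0 r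
  rw [hT, hT', pos_eq_pos_of_patch_eq hcell hR hTT']

end Locality

section Primitive

variable {d : ℕ} {X : Type*} [MetricSpace X] {Ω : TilingSpace d X}

/-- `s` is a primitive of the `1`-cochain `α`: the coboundary `(T, v) ↦ s(T - v) - s(T)` is `α`. -/
def IsPrimitive (s : Ω → Euc d) (α : Ω → Euc d → Euc d) : Prop :=
  ∀ T v, s (sub T v) - s T = α T v

theorem IsPrimitive.of_eventually {s : Ω → Euc d} {α : Ω → Euc d → Euc d}
    (hα : ∀ T x y, α T x + α (sub T x) y = α T (x + y))
    (hs : ∀ T, ∀ᶠ v in 𝓝 (0 : Euc d), s (sub T v) - s T = α T v) : IsPrimitive s α := by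
  intro T v
  have hconst : IsLocallyConstant fun v => s (sub T v) - s T - α T v := by
    rw [IsLocallyConstant.iff_eventually_eq]
    intro x
    rw [← map_add_left_nhds_zero x, eventually_map]
    filter_upwards [hs (sub T x)] with y hy
    rw [← hα, ← hy, sub_sub]
    abel
  have hzero : s (sub T 0) - s T - α T 0 = 0 := sub_eq_zero.2 (hs T).self_of_nhds
  exact sub_eq_zero.1 ((hconst.apply_eq_of_preconnectedSpace v 0).trans hzero)

end Primitive

variable {d : ℕ} {X X₁ X₂ : Type*} [MetricSpace X] [MetricSpace X₁] [MetricSpace X₂]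
  {Ω : TilingSpace d X} {Ω₁ : TilingSpace d X₁} {Ω₂ : TilingSpace d X₂}

theorem exists_isPrimitive_of_weakClass_eq {h₁ : C(Ω, Ω₁)} {hh₁ : OrbitPreserving h₁}
    {h₂ : C(Ω, Ω₂)} {hh₂ : OrbitPreserving h₂} (h : weakClass h₁ hh₁ = weakClass h₂ hh₂) :
    ∃ s : C(Ω, Euc d),
      IsPrimitive s fun T v => displacement hh₁ T v - displacement hh₂ T v := by
  obtain ⟨s, hs⟩ := QuotientAddGroup.eq.1 h.symm
  refine ⟨s, fun T v => ?_⟩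
  have hTv : s (sub T v) - s T = -displacement hh₂ T v + displacement hh₁ T v :=
    congrArg (fun α : Ω.weakCocycles => α.1 (T, v)) hs
  rw [hTv, neg_add_eq_sub]

section Transfer

variable {Y : Type*} [TopologicalSpace Y]

/-- The map `y ↦ h(y) - s(y)`, which moves each value of `h` along its orbit. -/
def translate (h : C(Y, Ω₂)) (s : C(Y, Euc d)) : C(Y, Ω₂) where
  toFun y := sub (h y) (s y)
  continuous_toFun := continuous_sub.comp (h.continuous.prodMk s.continuous)

theorem homotopic_translate (h : C(Y, Ω₂)) (s : C(Y, Euc d)) :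
    ContinuousMap.Homotopic h (translate h s) :=
  ⟨{ toFun := fun P => sub (h P.2) ((P.1 : ℝ) • s P.2)
     continuous_toFun := continuous_sub.comp <| (h.continuous.comp continuous_snd).prodMk <|
       (continuous_subtype_val.comp continuous_fst).smul (s.continuous.comp continuous_snd)
     map_zero_left := fun y => by simp [sub_zero]
     map_one_left := fun y => by simp [translate] }⟩

theorem translate_sub {h₁ : C(Ω, Ω₁)} (hh₁ : OrbitPreserving h₁) {h₂ : C(Ω, Ω₂)}
    (hh₂ : OrbitPreserving h₂) {s : C(Ω, Euc d)}
    (hs : IsPrimitive s fun T v => displacement hh₁ T v - displacement hh₂ T v) (T : Ω)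
    (v : Euc d) :
    translate h₂ s (sub T v) = sub (translate h₂ s T) (displacement hh₁ T v) := by
  change sub (h₂ (sub T v)) (s (sub T v)) = sub (sub (h₂ T) (s T)) _
  have hsv : s (sub T v) - s T = displacement hh₁ T v - displacement hh₂ T v := hs T v
  rw [sub_eq_sub_iff_add_eq_add] at hsv
  rw [displacement_spec hh₂, sub_sub, sub_sub, add_comm, hsv, add_comm]

/-- The map `h₁ T ↦ h₂ T - s T`, which turns a primitive `s` of the difference of the displacements
into a factor map. -/
def transfer (h₁ : Ω ≃ₜ Ω₁) (h₂ : C(Ω, Ω₂)) (s : C(Ω, Euc d)) : C(Ω₁, Ω₂) :=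
  (translate h₂ s).comp (h₁.symm : C(Ω₁, Ω))

theorem homotopic_transfer_comp (h₁ : Ω ≃ₜ Ω₁) (h₂ : C(Ω, Ω₂)) (s : C(Ω, Euc d)) :
    ContinuousMap.Homotopic h₂ ((transfer h₁ h₂ s).comp (h₁ : C(Ω, Ω₁))) := by
  have hcomp : (transfer h₁ h₂ s).comp (h₁ : C(Ω, Ω₁)) = translate h₂ s := by
    ext1 T
    simp [transfer]
  exact hcomp ▸ homotopic_translate h₂ s

theorem isFactorMap_transfer {h₁ : Ω ≃ₜ Ω₁} (hh₁ : IsOrbitEquivalence h₁) {h₂ : C(Ω, Ω₂)}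
    (hh₂ : OrbitPreserving h₂) {s : C(Ω, Euc d)}
    (hs : IsPrimitive s fun T v =>
      displacement hh₁.orbitPreserving T v - displacement hh₂ T v) :
    IsFactorMap (transfer h₁ h₂ s) := by
  intro T₁ x
  obtain ⟨T, rfl⟩ := h₁.surjective T₁
  obtain ⟨v, hv⟩ : ∃ v, h₁.symm (sub (h₁ T) x) = sub T v :=
    (hh₁ _ _).2 ⟨x, h₁.apply_symm_apply _⟩
  have hv' : h₁ (sub T v) = sub (h₁ T) x := by rw [← hv, h₁.apply_symm_apply]
  have hx : displacement hh₁.orbitPreserving T v = x :=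
    sub_injective (h₁ T) ((displacement_spec hh₁.orbitPreserving T v).symm.trans hv')
  change translate h₂ s (h₁.symm (sub (h₁ T) x)) = sub (translate h₂ s (h₁.symm (h₁ T))) x
  rw [hv, h₁.symm_apply_apply, translate_sub hh₁.orbitPreserving hh₂ hs, hx]

end Transfer

section LocalPositionDifference

theorem eventually_pos_sub {h : C(Ω, Ω₁)} (hh : OrbitPreserving h) {x : Euc d} {T : Ω}
    (hx : h T ∈ Ω₁.cell x) :
    ∀ᶠ v in 𝓝 (0 : Euc d), Ω₁.pos x (h (sub T v)) = Ω₁.pos x (h T) - displacement hh T v := by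
  obtain ⟨l, hl, hlx⟩ := Ω₁.exists_pos hx
  have hcont : Continuous fun v => dist (Ω₁.pos x (h T) - displacement hh T v) x :=
    (continuous_const.sub ((continuous_displacement hh).comp (Continuous.prodMk_right T))).dist
      continuous_const
  have hball : ∀ᶠ v in 𝓝 (0 : Euc d), dist (Ω₁.pos x (h T) - displacement hh T v) x < Ω₁.radius :=
    hcont.continuousAt.eventually_lt continuousAt_const <| by
      rwa [displacement_zero, _root_.sub_zero]
  filter_upwards [hball] with v hv
  refine Ω₁.pos_eq (p := (Ω₁.pos x (h T) - displacement hh T v, l)) ?_ hv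
  rw [displacement_spec hh T v]
  change (_ + displacement hh T v, l) ∈ (h T).1.carrier
  rwa [sub_add_cancel]

/-- Near each `T₀`, the function `s` is the position of a point of `h₂ T` minus the position of a
point of `h₁ T`, up to a constant. An equality of strong classes amounts to the existence of such an
`s`, with the constants coming from the Čech coboundary. -/
def IsLocalPosDifference (h₁ : Ω → Ω₁) (h₂ : Ω → Ω₂) (s : Ω → Euc d) : Prop :=
  ∀ T₀, ∃ x y c, h₁ T₀ ∈ Ω₁.cell x ∧ h₂ T₀ ∈ Ω₂.cell y ∧
    ∀ᶠ T in 𝓝 T₀, s T = Ω₂.pos y (h₂ T) - Ω₁.pos x (h₁ T) + c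

theorem exists_isLocalPosDifference_of_strongClass_eq {h₁ : C(Ω, Ω₁)} {F₁ : Ω₁.FLC}
    {h₂ : C(Ω, Ω₂)} {F₂ : Ω₂.FLC} (h : strongClass h₁ F₁ = strongClass h₂ F₂) :
    ∃ s : Ω → Euc d, IsLocalPosDifference h₁ h₂ s :=
  (Quotient.exact h).exists_eventually_eq (p := fun x T => Ω₁.pos x (h₁ T))
    (q := fun y T => Ω₂.pos y (h₂ T)) (fun _ _ _ _ _ => rfl) fun _ _ _ _ _ => rfl

namespace IsLocalPosDifference

theorem continuous {h₁ : C(Ω, Ω₁)} {h₂ : C(Ω, Ω₂)} {s : Ω → Euc d}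
    (hs : IsLocalPosDifference h₁ h₂ s) : Continuous s := by
  refine continuous_iff_continuousAt.2 fun T₀ => ?_
  obtain ⟨x, y, c, hx, hy, heq⟩ := hs T₀
  have hpos₁ : ContinuousAt (fun T => Ω₁.pos x (h₁ T)) T₀ :=
    (Ω₁.continuousAt_pos hx).comp h₁.continuous.continuousAt
  have hpos₂ : ContinuousAt (fun T => Ω₂.pos y (h₂ T)) T₀ :=
    (Ω₂.continuousAt_pos hy).comp h₂.continuous.continuousAt
  exact ((hpos₂.sub hpos₁).add continuousAt_const).congr (EventuallyEq.symm heq)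

theorem isPrimitive {h₁ : C(Ω, Ω₁)} (hh₁ : OrbitPreserving h₁) {h₂ : C(Ω, Ω₂)}
    (hh₂ : OrbitPreserving h₂) {s : Ω → Euc d} (hs : IsLocalPosDifference h₁ h₂ s) :
    IsPrimitive s fun T v => displacement hh₁ T v - displacement hh₂ T v := by
  refine .of_eventually (fun T x y => ?_) fun T => ?_
  · rw [← displacement_add hh₁, ← displacement_add hh₂]
    abel
  · obtain ⟨x, y, c, hx, hy, heq⟩ := hs T
    have hcont : Continuous (sub T) := continuous_sub.comp (Continuous.prodMk_right T)
    have hsub : Tendsto (sub T) (𝓝 0) (𝓝 T) := by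
      simpa only [sub_zero] using hcont.tendsto 0
    filter_upwards [hsub.eventually heq, eventually_pos_sub hh₁ hx, eventually_pos_sub hh₂ hy]
      with v hv hv₁ hv₂
    rw [hv, hv₁, hv₂, heq.self_of_nhds]
    abel

theorem isLocalMap_transfer [CompactSpace Ω₁] (F₂ : Ω₂.FLC) {h₁ : Ω ≃ₜ Ω₁} {h₂ : C(Ω, Ω₂)}
    {s : C(Ω, Euc d)} (hs : IsLocalPosDifference h₁ h₂ s) : IsLocalMap (transfer h₁ h₂ s) := by
  refine isLocalMap_of_eventually_patch_eq_comp_pos fun r T₁ => ?_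
  obtain ⟨T₀, rfl⟩ := h₁.surjective T₁
  obtain ⟨x, y, c, hx, hy, heq⟩ := hs T₀
  set Λ := (h₂ T₀).1.sub (Ω₂.pos y (h₂ T₀))
  have hpatch := h₂.continuous.continuousAt.eventually
    (F₂.eventually_patch_sub_pos_eq hy (r + (‖x‖ + Ω₁.radius + ‖c‖)))
  have hcell := h₁.continuous.continuousAt.eventually ((Ω₁.isOpen_cell x).mem_nhds hx)
  refine ⟨x, fun z => (Λ.sub (c - z)).patch 0 r, hx, ?_⟩
  rw [← h₁.map_nhds_eq, eventually_map]
  filter_upwards [heq, hpatch, hcell] with T hT hTpatch hTcell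
  have hval : (transfer h₁ h₂ s (h₁ T)).1 =
      ((h₂ T).1.sub (Ω₂.pos y (h₂ T))).sub (c - Ω₁.pos x (h₁ T)) := by
    change (h₂ (h₁.symm (h₁ T))).1.sub (s (h₁.symm (h₁ T))) = _
    rw [h₁.symm_apply_apply, LabeledDelone.sub_sub, hT]
    congr 1
    abel
  rw [hval]
  refine LabeledDelone.patch_sub_eq_patch_sub ?_ hTpatch
  obtain ⟨-, -, hdist⟩ := Ω₁.exists_pos hTcell
  rw [dist_eq_norm] at hdist
  linarith [norm_sub_le c (Ω₁.pos x (h₁ T)), norm_sub_norm_le (Ω₁.pos x (h₁ T)) x]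

end IsLocalPosDifference

end LocalPositionDifference

end TilingSpace

open TilingSpace in
theorem mainTheorem4_general {d : ℕ} {X X₁ X₂ : Type*} [MetricSpace X] [MetricSpace X₁]
    [MetricSpace X₂] {Ω : TilingSpace d X} {Ω₁ : TilingSpace d X₁} {Ω₂ : TilingSpace d X₂}
    {h₁ : Ω ≃ₜ Ω₁} (hh₁ : IsOrbitEquivalence h₁) {h₂ : C(Ω, Ω₂)} (hh₂ : OrbitPreserving h₂) :
    (weakClass (h₁ : C(Ω, Ω₁)) hh₁.orbitPreserving = weakClass h₂ hh₂ →
      ∃ φ : C(Ω₁, Ω₂), IsFactorMap φ ∧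
        ContinuousMap.Homotopic h₂ (φ.comp (h₁ : C(Ω, Ω₁)))) ∧
    (∀ (F₁ : Ω₁.FLC) (F₂ : Ω₂.FLC),
      strongClass (h₁ : C(Ω, Ω₁)) F₁ = strongClass h₂ F₂ →
        ∃ φ : C(Ω₁, Ω₂), IsLocalDerivation φ ∧
          ContinuousMap.Homotopic h₂ (φ.comp (h₁ : C(Ω, Ω₁)))) := by
  refine ⟨fun h => ?_, fun F₁ F₂ h => ?_⟩
  · obtain ⟨s, hs⟩ := exists_isPrimitive_of_weakClass_eq h
    exact ⟨transfer h₁ h₂ s, isFactorMap_transfer hh₁ hh₂ hs, homotopic_transfer_comp h₁ h₂ s⟩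
  · have := F₁.compactSpace
    obtain ⟨s, hs⟩ := exists_isLocalPosDifference_of_strongClass_eq h
    let s' : C(Ω, Euc d) := ⟨s, hs.continuous⟩
    have hfactor : IsFactorMap (transfer h₁ h₂ s') :=
      isFactorMap_transfer hh₁ hh₂ (hs.isPrimitive hh₁.orbitPreserving hh₂)
    have hlocal : IsLocalMap (transfer h₁ h₂ s') := hs.isLocalMap_transfer F₂
    exact ⟨transfer h₁ h₂ s', ⟨hlocal, hfactor⟩, homotopic_transfer_comp h₁ h₂ s'⟩

theorem mainTheorem4 {d : ℕ} {X X₁ X₂ : Type*}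
    [MetricSpace X] [CompactSpace X] [MetricSpace X₁] [CompactSpace X₁]
    [MetricSpace X₂] [CompactSpace X₂]
    (Ω : TilingSpace d X) (Ω₁ : TilingSpace d X₁) (Ω₂ : TilingSpace d X₂)
    (h₁ : Ω ≃ₜ Ω₁) (hh₁ : TilingSpace.IsOrbitEquivalence h₁)
    (h₂ : C(Ω, Ω₂)) (hh₂ : TilingSpace.OrbitPreserving h₂) :
    (TilingSpace.weakClass (h₁ : C(Ω, Ω₁)) hh₁.orbitPreserving = TilingSpace.weakClass h₂ hh₂ →
      ∃ φ : C(Ω₁, Ω₂), TilingSpace.IsFactorMap φ ∧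
        ContinuousMap.Homotopic h₂ (φ.comp (h₁ : C(Ω, Ω₁)))) ∧
    (∀ (_ : Ω.FLC) (F₁ : Ω₁.FLC) (F₂ : Ω₂.FLC),
      TilingSpace.strongClass (h₁ : C(Ω, Ω₁)) F₁ = TilingSpace.strongClass h₂ F₂ →
        ∃ φ : C(Ω₁, Ω₂), TilingSpace.IsLocalDerivation φ ∧
          ContinuousMap.Homotopic h₂ (φ.comp (h₁ : C(Ω, Ω₁)))) := by
  have ⟨weak, strong⟩ := mainTheorem4_general hh₁ hh₂
  exact ⟨weak, fun _ => strong⟩
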